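/- Let $\Bbbk$ be a field of characteristic $0$. For a $\Sigma_2$-module $E$ let $\mathcal F(E)$ be the free symmetric operad generated by $E$ in arity $2$, and for $R\subseteq\mathcal F(E)(3)$ let $\langle E;R\rangle=\mathcal F(E)/(R)$, where $(R)$ is the operad ideal generated by $R$. Write $\mathcal{C}om=\langle E_1;R_1\rangle$, where $E_1$ is the one-dimensional trivial $\Sigma_2$-module spanned by the product $a\cdot b$ and $R_1$ is associativity, and $\mathcal{L}ie=\langle E_2;R_2\rangle$, where $E_2$ is the one-dimensional sign module spanned by the bracket $[a,b]$ and $R_2$ is the Jacobi identity. Put $E=E_1\oplus E_2$ and let $\mathcal F(E)(3)_{ij}\subseteq\mathcal F(E)(3)$ be the $\Sigma_3$-submodule generated by the compositions $\mu(1,\nu)$ and $\mu(\nu,1)$ with $\mu\in E_i$, $\nu\in E_j$. For a $\Bbbk$-linear map $\mathcal D\colon\mathcal F(E)(3)_{12}\to\mathcal F(E)(3)_{21}$ let $R_{\mathcal D}=\{x-\mathcal D(x) : x\in\mathcal F(E)(3)_{12}\}$ and let $\mathcal P_{\mathcal D}=\langle E_1\oplus E_2;\,R_1\cup R_{\mathcal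 D}\cup R_2\rangle$. The morphisms $\mathcal{C}om\to\mathcal P_{\mathcal D}$ and $\mathcal{L}ie\to\mathcal P_{\mathcal D}$ and the operadic composition of $\mathcal P_{\mathcal D}$ induce linear maps $$\xi(n)\colon(\mathcal{L}ie\circ\mathcal{C}om)(n)=\bigoplus_{\pi}\Big(\mathcal{L}ie(\pi)\otimes\bigotimes_{B\in\pi}\mathcal{C}om(B)\Big)\longrightarrow\mathcal P_{\mathcal D}(n),\qquad \mu\otimes\bigotimes_{B}\nu_B\longmapsto\mu\big((\nu_B)_{B\in\pi}\big),$$ where $\pi$ runs over all partitions of $\{1,\dots,n\}$ into non-empty blocks. The map $\mathcal D$ is called an (operadic homogeneous quadratic) distributive law of $\mathcal{C}om$ over $\mathcal{L}ie$ if it is $\Sigma_3$-equivariant and $\xi(n)$ is an isomorphism for every $n\ge2$. **Theorem.** The only distributive law of $\mathcal{C}om$ over $\mathcal{L}ie$ is the trivial one: a linear map $\mathcal D\colon\mathcal F(E)(3)_{12}\to\mathcal F(E)(3)_{21}$ is a distributive law of $\mathcal{C}om$ over $\mathcal{L}ie$ if and only if $\mathcal D=0$. -/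

import Mathlib

open scoped TensorProduct DirectSum

noncomputable section

namespace OperadDL

/-! ### Tree monomials and the free operad on a set of binary symbols -/

/-- Planar binary trees with vertices decorated by `G` and leaves decorated by `A`. -/
inductive BTree (G A : Type) : Type
  | leaf (a : A) : BTree G A
  | node (g : G) (l r : BTree G A) : BTree G A

namespace BTree

variable {G H A B : Type}

/-- The list of leaf labels, from left to right. -/
def leaves : BTree G A → List A
  | leaf a => [a]
  | node _ l r => leaves l ++ leaves r

/-- Grafting: replace every leaf `a` of the tree by the tree `u a`. -/
def bind : BTree G A → (A → BTree G B) → BTree G B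
  | leaf a, u => u a
  | node g l r, u => node g (bind l u) (bind r u)

/-- Relabelling of the leaves. -/
def map (e : A → B) : BTree G A → BTree G B
  | leaf a => leaf (e a)
  | node g l r => node g (map e l) (map e r)

/-- Renaming of the vertex decorations. -/
def mapGen (φ : G → H) : BTree G A → BTree H A
  | leaf a => leaf a
  | node g l r => node (φ g) (mapGen φ l) (mapGen φ r)

/-- Every label is carried by exactly one leaf. -/
def Multilinear (t : BTree G A) : Prop :=
  t.leaves.Nodup ∧ ∀ a, a ∈ t.leaves

theorem leaves_bind (t : BTree G A) (u : A → BTree G B) :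
    (t.bind u).leaves = t.leaves.flatMap fun a => (u a).leaves := by
  induction t with
  | leaf a => simp [bind, leaves]
  | node g l r hl hr => simp [bind, leaves, hl, hr]

theorem leaves_map (e : A → B) (t : BTree G A) : (t.map e).leaves = t.leaves.map e := by
  induction t with
  | leaf a => simp [map, leaves]
  | node g l r hl hr => simp [map, leaves, hl, hr]

theorem leaves_mapGen (φ : G → H) (t : BTree G A) : (t.mapGen φ).leaves = t.leaves := by
  induction t with
  | leaf a => simp [mapGen, leaves]
  | node g l r hl hr => simp [mapGen, leaves, hl, hr]

theorem mapGen_bind (φ : G → H) (t : BTree G A) (u : A → BTree G B) :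
    (t.bind u).mapGen φ = (t.mapGen φ).bind fun a => (u a).mapGen φ := by
  induction t with
  | leaf a => simp [mapGen, bind]
  | node g l r hl hr => simp [mapGen, bind, hl, hr]

theorem mapGen_map (φ : G → H) (e : A → B) (t : BTree G A) :
    (t.map e).mapGen φ = (t.mapGen φ).map e := by
  induction t with
  | leaf a => simp [mapGen, map]
  | node g l r hl hr => simp [mapGen, map, hl, hr]

end BTree

/-- The fibre of `f` over `b`. -/
abbrev Fib {A B : Type} (f : A → B) (b : B) : Type := {a : A // f a = b}

/-- Tree monomials of arity `A`: the leaves are in bijection with `A`. (There are none when `A` is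
empty or infinite.) -/
def MTree (G A : Type) : Type := {t : BTree G A // t.Multilinear}

namespace MTree

variable {G H A B : Type}

/-- Relabelling along a bijection. -/
def map (e : A ≃ B) (t : MTree G A) : MTree G B :=
  ⟨t.1.map e, by
    refine ⟨?_, fun b => ?_⟩
    · rw [BTree.leaves_map]; exact t.2.1.map e.injective
    · rw [BTree.leaves_map, List.mem_map]; exact ⟨e.symm b, t.2.2 _, by simp⟩⟩

/-- Renaming of the vertex decorations. -/
def mapGen (φ : G → H) (t : MTree G A) : MTree H A :=
  ⟨t.1.mapGen φ, by
    unfold BTree.Multilinear; rw [BTree.leaves_mapGen]; exact t.2⟩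

/-- Operadic composition of tree monomials along `f : A → B`: the tree `u b`, whose leaves are
labelled by the fibre of `f` over `b`, is grafted on the leaf `b` of `t`. -/
def comp (f : A → B) (t : MTree G B) (u : ∀ b, MTree G (Fib f b)) : MTree G A :=
  ⟨t.1.bind fun b => (u b).1.map Subtype.val, by
    refine ⟨?_, fun a => ?_⟩
    · rw [BTree.leaves_bind, List.nodup_flatMap]
      refine ⟨fun b _ => ?_, t.2.1.imp fun {b c} hbc => ?_⟩
      · rw [BTree.leaves_map]; exact (u b).2.1.map Subtype.val_injective
      · simp only [Function.onFun, BTree.leaves_map]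
        intro a hb hc
        simp only [List.mem_map] at hb hc
        obtain ⟨x, -, rfl⟩ := hb
        obtain ⟨y, -, hy⟩ := hc
        exact hbc (by rw [← x.2, ← y.2, hy])
    · rw [BTree.leaves_bind, List.mem_flatMap]
      refine ⟨f a, t.2.2 _, ?_⟩
      rw [BTree.leaves_map, List.mem_map]
      exact ⟨⟨a, rfl⟩, (u (f a)).2.2 _, rfl⟩⟩

theorem mapGen_comp (φ : G → H) (f : A → B) (t : MTree G B) (u : ∀ b, MTree G (Fib f b)) :
    (comp f t u).mapGen φ = comp f (t.mapGen φ) fun b => (u b).mapGen φ := by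
  apply Subtype.ext
  simp only [comp, mapGen, BTree.mapGen_bind, BTree.mapGen_map]

theorem mapGen_map (φ : G → H) (e : A ≃ B) (t : MTree G A) :
    (t.map e).mapGen φ = (t.mapGen φ).map e :=
  Subtype.ext (BTree.mapGen_map φ e t.1)

/-- The corolla `g(x₀, x₁)` (for `σ = 1`), with its inputs permuted by `σ`. -/
def corolla (g : G) (σ : Equiv.Perm (Fin 2)) : MTree G (Fin 2) :=
  ⟨.node g (.leaf (σ 0)) (.leaf (σ 1)), by
    refine ⟨by simp [BTree.leaves], fun a => ?_⟩
    obtain ⟨i, rfl⟩ := σ.surjective a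
    fin_cases i <;> simp [BTree.leaves]⟩

/-- The tree monomial `g(h(x_{σ 0}, x_{σ 1}), x_{σ 2})`. -/
def lcomb (g h : G) (σ : Equiv.Perm (Fin 3)) : MTree G (Fin 3) :=
  ⟨.node g (.node h (.leaf (σ 0)) (.leaf (σ 1))) (.leaf (σ 2)), by
    refine ⟨by simp [BTree.leaves], fun a => ?_⟩
    obtain ⟨i, rfl⟩ := σ.surjective a
    fin_cases i <;> simp [BTree.leaves]⟩

/-- The tree monomial `g(x_{σ 0}, h(x_{σ 1}, x_{σ 2}))`. -/
def rcomb (g h : G) (σ : Equiv.Perm (Fin 3)) : MTree G (Fin 3) :=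
  ⟨.node g (.leaf (σ 0)) (.node h (.leaf (σ 1)) (.leaf (σ 2))), by
    refine ⟨by simp [BTree.leaves], fun a => ?_⟩
    obtain ⟨i, rfl⟩ := σ.surjective a
    fin_cases i <;> simp [BTree.leaves]⟩

end MTree

universe u

variable (k : Type u) [Field k]

/-- The component of arity `A` of the free symmetric operad on binary symbols `G` without any
symmetry (that is, on the free `Σ₂`-module with basis `G`). -/
abbrev FM (G A : Type) : Type u := MTree G A →₀ k

variable {k} {G H A B : Type}

/-- The class of a tree monomial in the free operad. -/
def FM.mono (t : MTree G A) : FM k G A := Finsupp.single t 1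

/-- Relabelling along a bijection (for `A = B = Fin n`, the action of the symmetric group). -/
def FM.relabel (e : A ≃ B) : FM k G A →ₗ[k] FM k G B := Finsupp.lmapDomain k k (MTree.map e)

/-- The morphism of free operads given by a map of symbols. -/
def FM.mapGen (φ : G → H) : FM k G A →ₗ[k] FM k H A := Finsupp.lmapDomain k k (MTree.mapGen φ)

open Classical in
/-- Operadic composition along `f : A → B`, the multilinear extension of `MTree.comp`. -/
def FM.comp [Finite B] (f : A → B) :
    FM k G B →ₗ[k] MultilinearMap k (fun b => FM k G (Fib f b)) (FM k G A) :=
  haveI := Fintype.ofFinite B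
  Finsupp.linearCombination k fun t =>
    (Finsupp.lmapDomain k k (MTree.comp f t)).compMultilinearMap
      ((PiTensorProduct.ofFinsuppEquiv' (R := k)).toLinearMap.compMultilinearMap
        (PiTensorProduct.tprod k))

theorem FM.comp_mono [Finite B] (f : A → B) (t : MTree G B) (u : ∀ b, MTree G (Fib f b)) :
    FM.comp (k := k) f (FM.mono t) (fun b => FM.mono (u b)) = FM.mono (MTree.comp f t u) := by
  classical
  let _ := Fintype.ofFinite B
  simp only [FM.comp, FM.mono, Finsupp.linearCombination_single, one_smul,
    LinearMap.compMultilinearMap_apply, LinearEquiv.coe_coe]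
  rw [PiTensorProduct.ofFinsuppEquiv'_tprod_single]
  simp

theorem FM.mapGen_comp [Finite B] (φ : G → H) (f : A → B) (x : FM k G B)
    (y : ∀ b, FM k G (Fib f b)) :
    FM.mapGen φ (FM.comp f x y) = FM.comp f (FM.mapGen φ x) fun b => FM.mapGen φ (y b) := by
  classical
  induction x using Finsupp.induction_linear with
  | zero => simp
  | add x x' hx hx' => simp [hx, hx']
  | single t c =>
    have hc : (Finsupp.single t c : FM k G B) = c • FM.mono t := by simp [FM.mono]
    rw [hc]
    simp only [map_smul, smul_apply]
    congr 1
    have key : (FM.mapGen (k := k) φ).compMultilinearMap (FM.comp f (FM.mono t)) =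
        (FM.comp f (FM.mapGen φ (FM.mono t))).compLinearMap fun b => FM.mapGen φ := by
      refine Module.Basis.ext_multilinear (fun b => Finsupp.basisSingleOne) fun v => ?_
      have h1 : ∀ {K C : Type} (s : MTree K C),
          (Finsupp.basisSingleOne s : FM k K C) = FM.mono s := fun s => by simp [FM.mono]
      have h2 : ∀ {C : Type} (s : MTree G C),
          FM.mapGen (k := k) φ (FM.mono s) = FM.mono (s.mapGen φ) := fun s => by
        simp [FM.mono, FM.mapGen]
      simp only [LinearMap.compMultilinearMap_apply, MultilinearMap.compLinearMap_apply, h1, h2,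
        FM.comp_mono, MTree.mapGen_comp]
    exact congrArg (fun m => m y) key

theorem FM.mapGen_relabel (φ : G → H) (e : A ≃ B) (x : FM k G A) :
    FM.mapGen φ (FM.relabel e x) = FM.relabel e (FM.mapGen φ x) := by
  simp only [FM.mapGen, FM.relabel, Finsupp.lmapDomain_apply, ← Finsupp.mapDomain_comp]
  congr 1
  funext t
  exact MTree.mapGen_map φ e t

/-! ### Operad ideals and presented operads -/

/-- A family of subspaces of the free operad is an operad ideal if it is stable under relabelling
and contains every composite one of whose factors belongs to it. -/
structure IsOperadIdeal (I : ∀ A : Type, Submodule k (FM k G A)) : Prop where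
  relabel : ∀ {A B : Type} (e : A ≃ B) (x : FM k G A), x ∈ I A → FM.relabel e x ∈ I B
  comp_left : ∀ {A B : Type} [Finite B] (f : A → B) (x : FM k G B) (y : ∀ b, FM k G (Fib f b)),
    x ∈ I B → FM.comp f x y ∈ I A
  comp_right : ∀ {A B : Type} [Finite B] (f : A → B) (x : FM k G B) (y : ∀ b, FM k G (Fib f b))
    (b : B), y b ∈ I (Fib f b) → FM.comp f x y ∈ I A

/-- The operad ideal generated by a set `S₂` of elements of arity two and a set `S₃` of elements of
arity three: the intersection of all operad ideals containing them. -/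
def idealGen (S₂ : Set (FM k G (Fin 2))) (S₃ : Set (FM k G (Fin 3))) (A : Type) :
    Submodule k (FM k G A) :=
  sInf {N | ∃ I : ∀ A : Type, Submodule k (FM k G A),
    IsOperadIdeal I ∧ S₂ ⊆ I (Fin 2) ∧ S₃ ⊆ I (Fin 3) ∧ N = I A}

theorem mem_idealGen {S₂ : Set (FM k G (Fin 2))} {S₃ : Set (FM k G (Fin 3))} {x : FM k G A} :
    x ∈ idealGen S₂ S₃ A ↔ ∀ I : ∀ A : Type, Submodule k (FM k G A),
      IsOperadIdeal I → S₂ ⊆ I (Fin 2) → S₃ ⊆ I (Fin 3) → x ∈ I A := by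
  simp only [idealGen, Submodule.mem_sInf, Set.mem_ofPred_eq]
  constructor
  · intro h I hI h2 h3
    exact h _ ⟨I, hI, h2, h3, rfl⟩
  · rintro h N ⟨I, hI, h2, h3, rfl⟩
    exact h I hI h2 h3

theorem isOperadIdeal_idealGen (S₂ : Set (FM k G (Fin 2))) (S₃ : Set (FM k G (Fin 3))) :
    IsOperadIdeal (idealGen S₂ S₃) where
  relabel e x hx := mem_idealGen.2 fun I hI h2 h3 => hI.relabel e x (mem_idealGen.1 hx I hI h2 h3)
  comp_left f x y hx := mem_idealGen.2 fun I hI h2 h3 =>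
    hI.comp_left f x y (mem_idealGen.1 hx I hI h2 h3)
  comp_right f x y b hy := mem_idealGen.2 fun I hI h2 h3 =>
    hI.comp_right f x y b (mem_idealGen.1 hy I hI h2 h3)

/-- The relations `g(x₀, x₁) = ε(g) g(x₁, x₀)`, which say that the transposition of `Σ₂` acts on the
symbol `g` by the sign `ε g`. -/
def symRel (k : Type u) [Field k] (ε : G → ℤˣ) : Set (FM k G (Fin 2)) :=
  Set.range fun g => FM.mono (MTree.corolla g 1) -
    ((ε g : ℤ) : k) • FM.mono (MTree.corolla g (Equiv.swap 0 1))

/-- The operad ideal of relations of the operad with binary generators `G`, symmetric or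
antisymmetric according to `ε`, and with relations represented by `R` in arity three. -/
def relIdeal (ε : G → ℤˣ) (R : Set (FM k G (Fin 3))) (A : Type) : Submodule k (FM k G A) :=
  idealGen (symRel k ε) R A

/-- The component of arity `A` of the quadratic operad `⟨E; R⟩`, where `E` is the `Σ₂`-module with
basis `G` on which the transposition acts by `g ↦ ε(g) g`, and where the relations are given by
representatives in the free operad on the symbols `G`. -/
abbrev QuadOp (ε : G → ℤˣ) (R : Set (FM k G (Fin 3))) (A : Type) : Type u :=
  FM k G A ⧸ relIdeal ε R A

/-- The component of arity `A` of the free operad `F(E)`. -/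
abbrev FreeOp (k : Type u) [Field k] (ε : G → ℤˣ) (A : Type) : Type u :=
  QuadOp (k := k) ε ∅ A

namespace QuadOp

variable {ε : G → ℤˣ} {R : Set (FM k G (Fin 3))}

/-- The quotient map from the free operad on the symbols. -/
abbrev mk (ε : G → ℤˣ) (R : Set (FM k G (Fin 3))) : FM k G A →ₗ[k] QuadOp ε R A :=
  (relIdeal ε R A).mkQ

/-- Relabelling along a bijection (for `A = B = Fin n`, the action of the symmetric group). -/
def relabel (e : A ≃ B) : QuadOp ε R A →ₗ[k] QuadOp ε R B :=
  Submodule.mapQ _ _ (FM.relabel e) fun x hx => (isOperadIdeal_idealGen _ _).relabel e x hx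

end QuadOp

section Quotient

variable {ι : Type} {M : ι → Type u} [∀ i, AddCommGroup (M i)] [∀ i, Module k (M i)]
  {P : Type u} [AddCommGroup P] [Module k P]

theorem multilinear_congr_mod [Finite ι] (N : ∀ i, Submodule k (M i)) (m : MultilinearMap k M P)
    (h : ∀ y i, y i ∈ N i → m y = 0) (y z : ∀ i, M i) (hyz : ∀ i, y i - z i ∈ N i) :
    m y = m z := by
  classical
  have := Fintype.ofFinite ι
  have key : ∀ s : Finset ι, m (s.piecewise y z) = m z := by
    intro s
    induction s using Finset.induction_on with
    | empty => simp
    | insert i s his ih =>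
      rw [← ih, ← sub_eq_zero, Finset.piecewise_insert]
      have : s.piecewise y z = Function.update (s.piecewise y z) i (z i) := by
        rw [eq_comm, Function.update_eq_self_iff]
        simp [his]
      conv_lhs => rw [this, Function.update_idem]
      rw [← MultilinearMap.map_update_sub]
      exact h _ i (by simpa using hyz i)
  simpa using key Finset.univ

theorem multilinear_out_update [DecidableEq ι] [Finite ι] (N : ∀ i, Submodule k (M i))
    (m : MultilinearMap k M P) (h : ∀ y i, y i ∈ N i → m y = 0) (y : ∀ i, M i ⧸ N i) (i : ι)
    (c : M i ⧸ N i) (v : M i) (hv : (N i).mkQ v = c) :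
    m (fun j => (Function.update y i c j).out) = m (Function.update (fun j => (y j).out) i v) := by
  refine multilinear_congr_mod N m h _ _ fun j => ?_
  rw [← Submodule.Quotient.eq]
  rcases eq_or_ne j i with rfl | hj
  · simpa [Submodule.Quotient.mk_out] using hv.symm
  · simp [hj]

/-- A multilinear map which vanishes as soon as one argument lies in the given subspace descends to
the quotients. -/
def multilinearLiftQ [Finite ι] (N : ∀ i, Submodule k (M i)) (m : MultilinearMap k M P)
    (h : ∀ y i, y i ∈ N i → m y = 0) : MultilinearMap k (fun i => M i ⧸ N i) P where
  toFun y := m fun i => (y i).out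
  map_update_add' y i a b := by
    have ha : (N i).mkQ a.out = a := Quotient.out_eq a
    have hb : (N i).mkQ b.out = b := Quotient.out_eq b
    rw [multilinear_out_update N m h y i _ (a.out + b.out) (by rw [map_add, ha, hb]),
      multilinear_out_update N m h y i _ _ ha, multilinear_out_update N m h y i _ _ hb,
      MultilinearMap.map_update_add]
  map_update_smul' y i c a := by
    have ha : (N i).mkQ a.out = a := Quotient.out_eq a
    rw [multilinear_out_update N m h y i _ (c • a.out) (by rw [map_smul, ha]),
      multilinear_out_update N m h y i _ _ ha, MultilinearMap.map_update_smul]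

theorem multilinearLiftQ_mk [Finite ι] (N : ∀ i, Submodule k (M i)) (m : MultilinearMap k M P)
    (h : ∀ y i, y i ∈ N i → m y = 0) (y : ∀ i, M i) :
    multilinearLiftQ N m h (fun i => (N i).mkQ (y i)) = m y :=
  multilinear_congr_mod N m h _ _ fun j => by
    rw [← Submodule.Quotient.eq]
    exact Quotient.out_eq ((N j).mkQ (y j))

theorem multilinearMap_quot_ext (N : ∀ i, Submodule k (M i))
    {m m' : MultilinearMap k (fun i => M i ⧸ N i) P}
    (h : ∀ y : ∀ i, M i, m (fun i => (N i).mkQ (y i)) = m' fun i => (N i).mkQ (y i)) :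
    m = m' := by
  ext z
  choose y hy using fun i => (N i).mkQ_surjective (z i)
  have : z = fun i => (N i).mkQ (y i) := funext fun i => (hy i).symm
  rw [this]
  exact h y

end Quotient

namespace QuadOp

variable {ε : G → ℤˣ} {R : Set (FM k G (Fin 3))}

theorem mk_comp_eq_zero [Finite B] (f : A → B) (x : FM k G B) (y : ∀ b, FM k G (Fib f b)) (b : B)
    (hy : y b ∈ relIdeal ε R (Fib f b)) :
    ((mk ε R).compMultilinearMap (FM.comp f x)) y = 0 := by
  rw [LinearMap.compMultilinearMap_apply, Submodule.mkQ_apply, Submodule.Quotient.mk_eq_zero]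
  exact (isOperadIdeal_idealGen _ _).comp_right f x y b hy

/-- `FM.comp` with values in the quotient, as a function of classes in all slots but the first. -/
def compAux (ε : G → ℤˣ) (R : Set (FM k G (Fin 3))) [Finite B] (f : A → B) :
    FM k G B →ₗ[k] MultilinearMap k (fun b => QuadOp ε R (Fib f b)) (QuadOp ε R A) where
  toFun x := multilinearLiftQ (fun b => relIdeal ε R (Fib f b))
    ((mk ε R).compMultilinearMap (FM.comp f x)) (mk_comp_eq_zero f x)
  map_add' x x' := multilinearMap_quot_ext _ fun y => by
    rw [add_apply, multilinearLiftQ_mk, multilinearLiftQ_mk, multilinearLiftQ_mk]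
    simp
  map_smul' c x := multilinearMap_quot_ext _ fun y => by
    rw [smul_apply, multilinearLiftQ_mk, multilinearLiftQ_mk]
    simp

theorem compAux_mk [Finite B] (f : A → B) (x : FM k G B) (y : ∀ b, FM k G (Fib f b)) :
    compAux ε R f x (fun b => mk ε R (y b)) = mk ε R (FM.comp f x y) :=
  multilinearLiftQ_mk (fun b => relIdeal ε R (Fib f b))
    ((mk ε R).compMultilinearMap (FM.comp f x)) (mk_comp_eq_zero f x) y

/-- Operadic composition along `f : A → B` in a presented operad. -/
def comp [Finite B] (f : A → B) :
    QuadOp ε R B →ₗ[k] MultilinearMap k (fun b => QuadOp ε R (Fib f b)) (QuadOp ε R A) :=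
  Submodule.liftQ _ (compAux ε R f) fun x hx => by
    rw [LinearMap.mem_ker]
    refine multilinearMap_quot_ext (fun b => relIdeal ε R (Fib f b)) fun y => ?_
    refine (compAux_mk f x y).trans ?_
    rw [zero_apply, Submodule.mkQ_apply, Submodule.Quotient.mk_eq_zero]
    exact (isOperadIdeal_idealGen _ _).comp_left f x y hx

theorem comp_mk [Finite B] (f : A → B) (x : FM k G B) (y : ∀ b, FM k G (Fib f b)) :
    comp f (mk ε R x) (fun b => mk ε R (y b)) = mk ε R (FM.comp f x y) :=
  compAux_mk f x y

theorem relIdeal_le_comap {ε' : H → ℤˣ} {R' : Set (FM k H (Fin 3))} (φ : G → H)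
    (hε : ∀ g, ε' (φ g) = ε g) (hR : ∀ x ∈ R, FM.mapGen φ x ∈ R') (A : Type) :
    relIdeal ε R A ≤ (relIdeal ε' R' A).comap (FM.mapGen φ) := by
  intro x hx
  have hI := isOperadIdeal_idealGen (symRel k ε') R'
  refine mem_idealGen.1 hx (fun C => (relIdeal ε' R' C).comap (FM.mapGen φ)) ⟨?_, ?_, ?_⟩ ?_ ?_
  · intro A B e x hx
    rw [Submodule.mem_comap, FM.mapGen_relabel]
    exact hI.relabel e _ hx
  · intro A B _ f x y hx
    rw [Submodule.mem_comap, FM.mapGen_comp]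
    exact hI.comp_left f _ _ hx
  · intro A B _ f x y b hy
    rw [Submodule.mem_comap, FM.mapGen_comp]
    exact hI.comp_right f _ _ b hy
  · rintro _ ⟨g, rfl⟩
    refine mem_idealGen.2 fun I _ h2 _ => h2 ⟨φ g, ?_⟩
    simp only [FM.mono, FM.mapGen, hε, map_sub, map_smul, Finsupp.lmapDomain_apply,
      Finsupp.mapDomain_single]
    rfl
  · intro x hx
    exact mem_idealGen.2 fun I _ _ h3 => h3 (hR x hx)

/-- The morphism of presented operads induced by a map of generators which respects the symmetries
and the relations. -/
def mapGen {ε' : H → ℤˣ} {R' : Set (FM k H (Fin 3))} (φ : G → H)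
    (hε : ∀ g, ε' (φ g) = ε g) (hR : ∀ x ∈ R, FM.mapGen φ x ∈ R') (A : Type) :
    QuadOp ε R A →ₗ[k] QuadOp ε' R' A :=
  Submodule.mapQ _ _ (FM.mapGen φ) (relIdeal_le_comap φ hε hR A)

end QuadOp

/-! ### Distributive laws -/

/-- The subspace of `F(E)(3)` spanned by the composites `μ(ν, 1)` and `μ(1, ν)`, and their
permutations, with `μ` in the span of `X` and `ν` in the span of `Y`. -/
def part3 (k : Type u) [Field k] (ε : G → ℤˣ) (X Y : Set G) :
    Submodule k (FreeOp k ε (Fin 3)) :=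
  Submodule.span k {x | ∃ g ∈ X, ∃ h ∈ Y, ∃ σ : Equiv.Perm (Fin 3),
    x = QuadOp.mk ε ∅ (FM.mono (MTree.lcomb g h σ)) ∨
    x = QuadOp.mk ε ∅ (FM.mono (MTree.rcomb g h σ))}

theorem relabel_mem_part3 {ε : G → ℤˣ} {X Y : Set G} (σ : Equiv.Perm (Fin 3))
    {x : FreeOp k ε (Fin 3)} (hx : x ∈ part3 k ε X Y) :
    QuadOp.relabel σ x ∈ part3 k ε X Y := by
  induction hx using Submodule.span_induction with
  | zero => simp
  | add x y _ _ hx hy => rw [map_add]; exact add_mem hx hy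
  | smul c x _ hx => rw [map_smul]; exact Submodule.smul_mem _ _ hx
  | mem x hx =>
    obtain ⟨g, hg, h, hh, τ, rfl | rfl⟩ := hx
    · refine Submodule.subset_span ⟨g, hg, h, hh, σ * τ, Or.inl ?_⟩
      simp [QuadOp.relabel, FM.relabel, FM.mono]
      rfl
    · refine Submodule.subset_span ⟨g, hg, h, hh, σ * τ, Or.inr ?_⟩
      simp [QuadOp.relabel, FM.relabel, FM.mono]
      rfl

variable {G₁ G₂ : Type}

/-- The space `F(E₁ ⊕ E₂)(3)₁₂`: an operation of `E₁` applied to the output of one of `E₂`. -/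
abbrev F12 (k : Type u) [Field k] (ε₁ : G₁ → ℤˣ) (ε₂ : G₂ → ℤˣ) :
    Submodule k (FreeOp k (Sum.elim ε₁ ε₂) (Fin 3)) :=
  part3 k (Sum.elim ε₁ ε₂) (Set.range Sum.inl) (Set.range Sum.inr)

/-- The space `F(E₁ ⊕ E₂)(3)₂₁`: an operation of `E₂` applied to the output of one of `E₁`. -/
abbrev F21 (k : Type u) [Field k] (ε₁ : G₁ → ℤˣ) (ε₂ : G₂ → ℤˣ) :
    Submodule k (FreeOp k (Sum.elim ε₁ ε₂) (Fin 3)) :=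
  part3 k (Sum.elim ε₁ ε₂) (Set.range Sum.inr) (Set.range Sum.inl)

variable {ε₁ : G₁ → ℤˣ} {ε₂ : G₂ → ℤˣ}

/-- Equivariance of a linear map `F(E)(3)₁₂ → F(E)(3)₂₁` under the symmetric group `Σ₃`. -/
def IsEquivariant (D : F12 k ε₁ ε₂ →ₗ[k] F21 k ε₁ ε₂) : Prop :=
  ∀ (σ : Equiv.Perm (Fin 3)) (x : F12 k ε₁ ε₂),
    D ⟨QuadOp.relabel σ x.1, relabel_mem_part3 σ x.2⟩ =
      ⟨QuadOp.relabel σ (D x).1, relabel_mem_part3 σ (D x).2⟩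

/-- The relations `R₁`, `R₂`, and `x - D x` for `x` in `F(E)(3)₁₂`, given by all their
representatives. -/
def combinedRel (R₁ : Set (FM k G₁ (Fin 3))) (R₂ : Set (FM k G₂ (Fin 3)))
    (D : F12 k ε₁ ε₂ →ₗ[k] F21 k ε₁ ε₂) : Set (FM k (G₁ ⊕ G₂) (Fin 3)) :=
  FM.mapGen Sum.inl '' R₁ ∪ FM.mapGen Sum.inr '' R₂ ∪
    {z | ∃ x : F12 k ε₁ ε₂, QuadOp.mk (Sum.elim ε₁ ε₂) ∅ z = x.1 - (D x).1}

theorem mapGen_inl_mem (R₁ : Set (FM k G₁ (Fin 3))) (R₂ : Set (FM k G₂ (Fin 3)))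
    (D : F12 k ε₁ ε₂ →ₗ[k] F21 k ε₁ ε₂) :
    ∀ x ∈ R₁, FM.mapGen Sum.inl x ∈ combinedRel R₁ R₂ D :=
  fun _ hx => Set.mem_union_left _ (Set.mem_union_left _ (Set.mem_image_of_mem _ hx))

theorem mapGen_inr_mem (R₁ : Set (FM k G₁ (Fin 3))) (R₂ : Set (FM k G₂ (Fin 3)))
    (D : F12 k ε₁ ε₂ →ₗ[k] F21 k ε₁ ε₂) :
    ∀ x ∈ R₂, FM.mapGen Sum.inr x ∈ combinedRel R₁ R₂ D :=
  fun _ hx => Set.mem_union_left _ (Set.mem_union_right _ (Set.mem_image_of_mem _ hx))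

/-- The combined operad `⟨E₁ ⊕ E₂; R₁ ⊕ R_D ⊕ R₂⟩`. -/
abbrev CombinedOp (R₁ : Set (FM k G₁ (Fin 3))) (R₂ : Set (FM k G₂ (Fin 3)))
    (D : F12 k ε₁ ε₂ →ₗ[k] F21 k ε₁ ε₂) (A : Type) : Type u :=
  QuadOp (Sum.elim ε₁ ε₂) (combinedRel R₁ R₂ D) A

/-- The morphism `P₁ → P`, where `P₁ = ⟨E₁; R₁⟩` and `P` is the combined operad. -/
def incl₁ (R₁ : Set (FM k G₁ (Fin 3))) (R₂ : Set (FM k G₂ (Fin 3)))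
    (D : F12 k ε₁ ε₂ →ₗ[k] F21 k ε₁ ε₂) (A : Type) :
    QuadOp ε₁ R₁ A →ₗ[k] CombinedOp R₁ R₂ D A :=
  QuadOp.mapGen (ε := ε₁) (ε' := Sum.elim ε₁ ε₂) (R := R₁) (R' := combinedRel R₁ R₂ D) Sum.inl
    (Sum.elim_inl ε₁ ε₂) (mapGen_inl_mem R₁ R₂ D) A

/-- The morphism `P₂ → P`, where `P₂ = ⟨E₂; R₂⟩` and `P` is the combined operad. -/
def incl₂ (R₁ : Set (FM k G₁ (Fin 3))) (R₂ : Set (FM k G₂ (Fin 3)))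
    (D : F12 k ε₁ ε₂ →ₗ[k] F21 k ε₁ ε₂) (A : Type) :
    QuadOp ε₂ R₂ A →ₗ[k] CombinedOp R₁ R₂ D A :=
  QuadOp.mapGen (ε := ε₂) (ε' := Sum.elim ε₁ ε₂) (R := R₂) (R' := combinedRel R₁ R₂ D) Sum.inr
    (Sum.elim_inr ε₁ ε₂) (mapGen_inr_mem R₁ R₂ D) A

/-- The component of arity `A` of the composite `P₂ ∘ P₁` of collections: the direct sum, over all
partitions of `A`, of `P₂(blocks) ⊗ ⨂ P₁(block)`. -/
abbrev Composite (ε₂ : G₂ → ℤˣ) (R₂ : Set (FM k G₂ (Fin 3))) (ε₁ : G₁ → ℤˣ)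
    (R₁ : Set (FM k G₁ (Fin 3))) (A : Type) : Type u :=
  ⨁ s : Setoid A, QuadOp ε₂ R₂ (Quotient s) ⊗[k]
    PiTensorProduct k fun q : Quotient s => QuadOp ε₁ R₁ (Fib (Quotient.mk s) q)

open Classical in
/-- The map `ξ : (P₂ ∘ P₁)(A) → P(A)`, `μ ⊗ (⨂ ν_q) ↦ μ(ν_q)`. -/
def xi (R₁ : Set (FM k G₁ (Fin 3))) (R₂ : Set (FM k G₂ (Fin 3)))
    (D : F12 k ε₁ ε₂ →ₗ[k] F21 k ε₁ ε₂) (A : Type) [Finite A] :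
    Composite ε₂ R₂ ε₁ R₁ A →ₗ[k] CombinedOp R₁ R₂ D A :=
  DirectSum.toModule k (Setoid A) _ fun s =>
    TensorProduct.lift
      ((PiTensorProduct.lift (R := k)).toLinearMap ∘ₗ
        MultilinearMap.compLinearMapₗ (fun _ => incl₁ R₁ R₂ D _) ∘ₗ
        QuadOp.comp (Quotient.mk s) ∘ₗ
        incl₂ R₁ R₂ D (Quotient s))

open Classical in
theorem xi_apply (R₁ : Set (FM k G₁ (Fin 3))) (R₂ : Set (FM k G₂ (Fin 3)))
    (D : F12 k ε₁ ε₂ →ₗ[k] F21 k ε₁ ε₂) (A : Type) [Finite A] (s : Setoid A)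
    (μ : QuadOp ε₂ R₂ (Quotient s)) (ν : ∀ q, QuadOp ε₁ R₁ (Fib (Quotient.mk s) q)) :
    xi R₁ R₂ D A (DirectSum.lof k (Setoid A)
      (fun s => QuadOp ε₂ R₂ (Quotient s) ⊗[k]
        PiTensorProduct k fun q : Quotient s => QuadOp ε₁ R₁ (Fib (Quotient.mk s) q)) s
      (μ ⊗ₜ[k] PiTensorProduct.tprod k ν)) =
    QuadOp.comp (Quotient.mk s) (incl₂ R₁ R₂ D _ μ) fun q => incl₁ R₁ R₂ D _ (ν q) := by
  simp [xi]

/-- `D` is an (operadic, homogeneous, quadratic) distributive law of `P₁ = ⟨E₁; R₁⟩` over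
`P₂ = ⟨E₂; R₂⟩`: it is `Σ₃`-equivariant, and `ξ(n) : (P₂ ∘ P₁)(n) → P(n)` is an isomorphism for
every `n ≥ 2`. -/
def IsDistributiveLaw (R₁ : Set (FM k G₁ (Fin 3))) (R₂ : Set (FM k G₂ (Fin 3)))
    (D : F12 k ε₁ ε₂ →ₗ[k] F21 k ε₁ ε₂) : Prop :=
  IsEquivariant D ∧ ∀ n : ℕ, 2 ≤ n → Function.Bijective (xi R₁ R₂ D (Fin n))

/-! ### The operads of commutative associative algebras and of Lie algebras -/

/-- The generator of `Com` is symmetric. -/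
def comSign : Unit → ℤˣ := fun _ => 1

/-- The generator of `Lie` is antisymmetric. -/
def lieSign : Unit → ℤˣ := fun _ => -1

/-- Associativity, `(x₀ x₁) x₂ - x₀ (x₁ x₂)`. -/
def comRel (k : Type u) [Field k] : Set (FM k Unit (Fin 3)) :=
  {FM.mono (MTree.lcomb () () 1) - FM.mono (MTree.rcomb () () 1)}

/-- The Jacobi identity, `[[x₀, x₁], x₂] + [[x₁, x₂], x₀] + [[x₂, x₀], x₁]`. -/
def lieRel (k : Type u) [Field k] : Set (FM k Unit (Fin 3)) :=
  {FM.mono (MTree.lcomb () () 1) + FM.mono (MTree.lcomb () () (finRotate 3)) +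
    FM.mono (MTree.lcomb () () (finRotate 3 ^ 2))}

end OperadDL

end

noncomputable section

namespace OperadDL

universe u

section

/-! ### Evaluation of trees in algebras -/

namespace BTree

variable {G H A B C : Type}

/-! Necessity. As a Σ₃-module, F(E)(3)₁₂ is generated by x₀[x₁,x₂], which changes sign when x₁ and
x₂ are exchanged. An equivariant D sends it to an element with the same symmetry, and since 2 is
invertible such an element is r([x₀x₁,x₂] − [x₂x₀,x₁]) for a scalar r
(`exists_eq_smul_of_isEquivariant`); thus D = 0 as soon as r = 0. Now expand xy[z,w] twice. Read as
(xy)[z,w] it gives r times brackets of a triple product with a single letter; read as x(y[z,w]) it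
gives r² times such brackets, together with r²[zx,wy] and −r²[wx,yz]. Associativity makes the
difference a relation (`combIdeal_four`). If ξ(4) is injective, this relation must hold in the
direct sum over partitions, where the component at {x,z},{y,w} is, up to sign, r² times a tensor
that is nonzero by `stackTensor_corolla_ne_zero`. Hence r = 0.

Sufficiency. For D = 0 a product with a bracket as a factor is zero, so every tree monomial is zero
or a bracket monomial in products (`eq_expand_or_mem_treeIdeal`), and ξ is surjective. For
injectivity, the free Lie algebra on the semigroup of subsets of A under union becomes an algebra
over the combined operad: generators multiply by union, and a product with a bracket is zero.
Evaluating at singletons turns the composite over a partition into the same Lie monomial in its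
blocks, from which `blockPart` recovers the Lie factor; the Com factors carry no information because
Com is spanned by one monomial in each arity.

Both halves move between operads and free algebras. Any algebra with an ideal yields an operad ideal
(`FM.relIdeal_le_evalIdeal`), which bounds the relations from above. Conversely, the multilinear
part of a relation in a free algebra is an operadic relation (`multilinearPart_mem`), so identities
can be derived with elements instead of permuted tree monomials. -/

theorem bind_map (t : BTree G A) (e : A → B) (u : B → BTree G C) :
    (t.map e).bind u = t.bind fun a => u (e a) := by
  induction t with
  | leaf a => rfl
  | node g l r hl hr => simp [map, bind, hl, hr]

theorem map_bind (t : BTree G A) (u : A → BTree G B) (e : B → C) :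
    (t.bind u).map e = t.bind fun a => (u a).map e := by
  induction t with
  | leaf a => rfl
  | node g l r hl hr => simp [map, bind, hl, hr]

theorem map_map (t : BTree G A) (e : A → B) (e' : B → C) :
    (t.map e).map e' = t.map fun a => e' (e a) := by
  induction t with
  | leaf a => rfl
  | node g l r hl hr => simp [map, hl, hr]

theorem map_id (t : BTree G A) : t.map (fun a => a) = t := by
  induction t with
  | leaf a => rfl
  | node g l r hl hr => simp [map, hl, hr]

theorem map_injective {e : A → B} (he : Function.Injective e) :
    Function.Injective (map (G := G) e) := by
  intro t
  induction t with
  | leaf a => rintro (b | ⟨g, l, r⟩) h <;> simp_all [map, he.eq_iff]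
  | node g l r hl hr =>
    rintro (b | ⟨g', l', r'⟩) h
    · simp [map] at h
    · simp only [map, node.injEq] at h
      rw [h.1, hl h.2.1, hr h.2.2]

theorem leaves_ne_nil (t : BTree G A) : t.leaves ≠ [] := by
  induction t with
  | leaf a => simp [leaves]
  | node g l r hl hr => simp [leaves, hl]

theorem exists_map_eq (e : A → B) (t : BTree G B) (h : ∀ b ∈ t.leaves, ∃ a, e a = b) :
    ∃ t' : BTree G A, t'.map e = t := by
  induction t with
  | leaf b =>
    obtain ⟨a, rfl⟩ := h b (by simp [leaves])
    exact ⟨leaf a, rfl⟩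
  | node g l r hl hr =>
    obtain ⟨l', rfl⟩ := hl fun b hb => h b (by simp [leaves, hb])
    obtain ⟨r', rfl⟩ := hr fun b hb => h b (by simp [leaves, hb])
    exact ⟨node g l' r', rfl⟩

variable {k : Type u} [Field k] {M : Type*} [AddCommGroup M] [Module k M]

/-- The value of a tree in an algebra `M` with binary operations `ops`. -/
def eval (ops : G → M →ₗ[k] M →ₗ[k] M) (v : A → M) : BTree G A → M
  | leaf a => v a
  | node g l r => ops g (eval ops v l) (eval ops v r)

variable (ops : G → M →ₗ[k] M →ₗ[k] M)

theorem eval_bind (t : BTree G A) (u : A → BTree G B) (v : B → M) :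
    eval ops v (t.bind u) = eval ops (fun a => eval ops v (u a)) t := by
  induction t with
  | leaf a => rfl
  | node g l r hl hr => simp [bind, eval, hl, hr]

theorem eval_map (t : BTree G A) (e : A → B) (v : B → M) :
    eval ops v (t.map e) = eval ops (fun a => v (e a)) t := by
  induction t with
  | leaf a => rfl
  | node g l r hl hr => simp [map, eval, hl, hr]

theorem eval_mapGen (t : BTree H A) (φ : H → G) (v : A → M) :
    eval ops v (t.mapGen φ) = eval (fun h => ops (φ h)) v t := by
  induction t with
  | leaf a => rfl
  | node g l r hl hr => simp [mapGen, eval, hl, hr]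

theorem eval_congr (t : BTree G A) {v w : A → M} (h : ∀ a ∈ t.leaves, v a = w a) :
    eval ops v t = eval ops w t := by
  induction t with
  | leaf a => exact h a (by simp [leaves])
  | node g l r hl hr =>
    simp only [eval]
    rw [hl fun a ha => h a (by simp [leaves, ha]), hr fun a ha => h a (by simp [leaves, ha])]

theorem eval_update_of_notMem [DecidableEq A] (t : BTree G A) (v : A → M) {a : A}
    (ha : a ∉ t.leaves) (x : M) : eval ops (Function.update v a x) t = eval ops v t :=
  eval_congr ops t fun b hb =>
    Function.update_of_ne (fun h : b = a => ha (h ▸ hb)) _ _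

/-- Since the label sits on exactly one leaf, only one branch at each vertex depends on it. The
linear map φ gives additivity and homogeneity of `MTree.eval` at once. -/
theorem eval_update [DecidableEq A] (t : BTree G A) (ht : t.leaves.Nodup) (v : A → M) {a : A}
    (ha : a ∈ t.leaves) :
    ∃ φ : M →ₗ[k] M, ∀ x, eval ops (Function.update v a x) t = φ x := by
  induction t with
  | leaf b =>
    obtain rfl : a = b := by simpa [leaves] using ha
    exact ⟨LinearMap.id, fun x => by simp [eval]⟩
  | node g l r hl hr =>
    simp only [leaves, List.nodup_append, List.mem_append] at ht ha
    rcases ha with h | h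
    · obtain ⟨φ, hφ⟩ := hl ht.1 h
      have hr' : a ∉ r.leaves := fun h' => ht.2.2 a h a h' rfl
      exact ⟨(ops g).flip (eval ops v r) ∘ₗ φ, fun x => by
        simp [eval, hφ, eval_update_of_notMem ops r v hr']⟩
    · obtain ⟨φ, hφ⟩ := hr ht.2.1 h
      have hl' : a ∉ l.leaves := fun h' => ht.2.2 a h' a h rfl
      exact ⟨ops g (eval ops v l) ∘ₗ φ, fun x => by
        simp [eval, hφ, eval_update_of_notMem ops l v hl']⟩

theorem eval_mem {N : Submodule k M} (hl : ∀ g x y, x ∈ N → ops g x y ∈ N)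
    (hr : ∀ g x y, y ∈ N → ops g x y ∈ N) (t : BTree G A) (v : A → M) {a : A}
    (ha : a ∈ t.leaves) (hv : v a ∈ N) : eval ops v t ∈ N := by
  induction t with
  | leaf b =>
    obtain rfl : a = b := by simpa [leaves] using ha
    exact hv
  | node g l r ihl ihr =>
    simp only [leaves, List.mem_append] at ha
    rcases ha with h | h
    · exact hl _ _ _ (ihl h)
    · exact hr _ _ _ (ihr h)

end BTree

/-! ### Values of tree monomials and of free operads in algebras -/

variable {k : Type u} [Field k] {G H A B C : Type} {M : Type*} [AddCommGroup M] [Module k M]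

/-- The value of a tree monomial in an algebra, as a multilinear map of the labels of its leaves. -/
def MTree.eval (ops : G → M →ₗ[k] M →ₗ[k] M) (t : MTree G A) :
    MultilinearMap k (fun _ : A => M) M where
  toFun v := t.1.eval ops v
  map_update_add' v a x y := by
    obtain ⟨φ, hφ⟩ := BTree.eval_update ops t.1 t.2.1 v (t.2.2 a)
    simp [hφ]
  map_update_smul' v a c x := by
    obtain ⟨φ, hφ⟩ := BTree.eval_update ops t.1 t.2.1 v (t.2.2 a)
    simp [hφ]

namespace MTree

@[simp] theorem map_val (e : A ≃ B) (t : MTree G A) : (t.map e).1 = t.1.map e := rfl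

@[simp] theorem mapGen_val (φ : G → H) (t : MTree G A) : (t.mapGen φ).1 = t.1.mapGen φ := rfl

@[simp] theorem comp_val (f : A → B) (t : MTree G B) (u : ∀ b, MTree G (Fib f b)) :
    (comp f t u).1 = t.1.bind fun b => (u b).1.map Subtype.val := rfl

@[simp] theorem corolla_val (g : G) (σ : Equiv.Perm (Fin 2)) :
    (corolla g σ).1 = .node g (.leaf (σ 0)) (.leaf (σ 1)) := rfl

@[simp] theorem lcomb_val (g h : G) (σ : Equiv.Perm (Fin 3)) :
    (lcomb g h σ).1 = .node g (.node h (.leaf (σ 0)) (.leaf (σ 1))) (.leaf (σ 2)) := rfl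

@[simp] theorem rcomb_val (g h : G) (σ : Equiv.Perm (Fin 3)) :
    (rcomb g h σ).1 = .node g (.leaf (σ 0)) (.node h (.leaf (σ 1)) (.leaf (σ 2))) := rfl

/-- The tree underlying a tree monomial, with relabelled leaves. -/
def mapTree (j : C → B) (t : MTree G C) : BTree G B := t.1.map j

theorem mapTree_injective {j : C → B} (hj : Function.Injective j) :
    Function.Injective (mapTree (G := G) j) :=
  fun _ _ h => Subtype.ext (BTree.map_injective hj h)

end MTree

theorem MTree.eval_apply (ops : G → M →ₗ[k] M →ₗ[k] M) (t : MTree G A) (v : A → M) :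
    t.eval ops v = t.1.eval ops v := rfl

namespace FM

variable (ops : G → M →ₗ[k] M →ₗ[k] M)

/-- The value of an element of the free operad in an algebra, for a fixed labelling of the
leaves. -/
def evalAt (v : A → M) : FM k G A →ₗ[k] M :=
  Finsupp.linearCombination k fun t => t.1.eval ops v

/-- The value of an element of the free operad in an algebra, as a multilinear map of the labels of
the leaves. -/
def eval : FM k G A →ₗ[k] MultilinearMap k (fun _ : A => M) M :=
  Finsupp.linearCombination k (MTree.eval ops)

@[simp]
theorem evalAt_mono (t : MTree G A) (v : A → M) :
    evalAt ops v (mono t : FM k G A) = t.1.eval ops v := by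
  simp [evalAt, mono]

theorem mapGen_mono (φ : G → H) (t : MTree G A) :
    mapGen (k := k) φ (mono t) = mono (t.mapGen φ) := by
  simp [mono, mapGen]

theorem relabel_mono (e : A ≃ B) (t : MTree G A) :
    relabel (k := k) e (mono t) = mono (t.map e) := by
  simp [mono, relabel]

/-- Linear maps on the free operad agree if they agree on tree monomials. -/
theorem hom_ext {P : Type*} [AddCommMonoid P] [Module k P] {φ ψ : FM k G A →ₗ[k] P}
    (h : ∀ t, φ (mono t) = ψ (mono t)) : φ = ψ := by
  ext t
  exact h t

theorem eval_apply (x : FM k G A) (v : A → M) : eval ops x v = evalAt ops v x := by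
  induction x using Finsupp.induction_linear with
  | zero => simp
  | add x y hx hy => simp [hx, hy]
  | single t c => simp [eval, evalAt, MTree.eval_apply]

theorem evalAt_relabel (e : A ≃ B) (x : FM k G A) (v : B → M) :
    evalAt ops v (relabel e x) = evalAt ops (fun a => v (e a)) x := by
  have : evalAt ops v ∘ₗ relabel e = evalAt (k := k) ops fun a => v (e a) :=
    hom_ext fun t => by simp [relabel_mono, BTree.eval_map]
  exact LinearMap.congr_fun this x

theorem evalAt_mapGen (φ : H → G) (x : FM k H A) (v : A → M) :
    evalAt ops v (mapGen φ x) = evalAt (fun h => ops (φ h)) v x := by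
  have : evalAt ops v ∘ₗ mapGen φ = evalAt (k := k) (fun h => ops (φ h)) v :=
    hom_ext fun t => by simp [mapGen_mono, BTree.eval_mapGen]
  exact LinearMap.congr_fun this x

theorem evalAt_comp [Finite B] (f : A → B) (x : FM k G B) (y : ∀ b, FM k G (Fib f b))
    (v : A → M) :
    evalAt ops v (comp f x y) = evalAt ops (fun b => evalAt ops (fun a => v a.1) (y b)) x := by
  classical
  induction x using Finsupp.induction_linear with
  | zero => simp
  | add x x' hx hx' => simp [hx, hx']
  | single t c =>
    have hc : (Finsupp.single t c : FM k G B) = c • FM.mono t := by simp [FM.mono]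
    rw [hc]
    simp only [map_smul, smul_apply]
    congr 1
    have key : (evalAt ops v).compMultilinearMap (FM.comp f (FM.mono t)) =
        (t.eval ops).compLinearMap fun b => evalAt (k := k) ops fun a : Fib f b => v a.1 := by
      refine Module.Basis.ext_multilinear (fun b => Finsupp.basisSingleOne) fun w => ?_
      have h1 : ∀ {C : Type} (s : MTree G C),
          (Finsupp.basisSingleOne s : FM k G C) = FM.mono s := fun s => by simp [FM.mono]
      simp only [LinearMap.compMultilinearMap_apply, MultilinearMap.compLinearMap_apply, h1,
        FM.comp_mono, evalAt_mono, MTree.eval_apply, MTree.comp_val, BTree.eval_bind, BTree.eval_map]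
    exact (congrArg (fun m => m y) key).trans (evalAt_mono ops t _).symm

/-- The elements of the free operad all of whose values in an algebra lie in a given subspace. -/
def evalIdeal (N : Submodule k M) (A : Type) : Submodule k (FM k G A) :=
  ⨅ v : A → M, N.comap (evalAt ops v)

theorem mem_evalIdeal {N : Submodule k M} {x : FM k G A} :
    x ∈ evalIdeal ops N A ↔ ∀ v, evalAt ops v x ∈ N := by
  simp [evalIdeal]

/-- Composition corresponds to substitution of values. For `comp_right`, every tree monomial
contains the leaf b, so one value in the two-sided ideal N pulls the whole value into N. -/
theorem isOperadIdeal_evalIdeal {N : Submodule k M} (hl : ∀ g x y, x ∈ N → ops g x y ∈ N)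
    (hr : ∀ g x y, y ∈ N → ops g x y ∈ N) : IsOperadIdeal (evalIdeal ops N) where
  relabel e x hx := by
    rw [mem_evalIdeal] at hx ⊢
    intro v
    rw [evalAt_relabel]
    exact hx _
  comp_left f x y hx := by
    rw [mem_evalIdeal] at hx ⊢
    intro v
    rw [evalAt_comp]
    exact hx _
  comp_right f x y b hy := by
    rw [mem_evalIdeal] at hy ⊢
    intro v
    rw [evalAt_comp]
    induction x using Finsupp.induction_linear with
    | zero => simp
    | add x x' hx hx' => rw [map_add]; exact add_mem hx hx'
    | single t c =>
      rw [evalAt, Finsupp.linearCombination_single]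
      exact N.smul_mem _ (BTree.eval_mem ops hl hr t.1 _ (t.2.2 b) (hy _))

/-- The relations of a presented operad hold modulo `N` in an algebra as soon as the defining
relations do. -/
theorem relIdeal_le_evalIdeal {ε : G → ℤˣ} {R : Set (FM k G (Fin 3))} {N : Submodule k M}
    (hl : ∀ g x y, x ∈ N → ops g x y ∈ N) (hr : ∀ g x y, y ∈ N → ops g x y ∈ N)
    (hs : ∀ g x y, ops g x y - ((ε g : ℤ) : k) • ops g y x ∈ N)
    (hR : ∀ x ∈ R, ∀ v, evalAt ops v x ∈ N) : relIdeal ε R A ≤ evalIdeal ops N A := by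
  intro x hx
  refine mem_idealGen.1 hx _ (isOperadIdeal_evalIdeal ops hl hr) ?_ fun x hx =>
    (mem_evalIdeal ops).2 (hR x hx)
  rintro _ ⟨g, rfl⟩
  refine (mem_evalIdeal ops).2 fun v => ?_
  simpa [BTree.eval] using hs g (v 0) (v 1)

end FM

theorem mem_relIdeal_of_mem {ε : G → ℤˣ} {R : Set (FM k G (Fin 3))} {x : FM k G (Fin 3)}
    (hx : x ∈ R) : x ∈ relIdeal ε R (Fin 3) :=
  mem_idealGen.2 fun _ _ _ h3 => h3 hx

theorem corolla_mem_relIdeal (ε : G → ℤˣ) (R : Set (FM k G (Fin 3))) (g : G) :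
    FM.mono (MTree.corolla g 1) - ((ε g : ℤ) : k) • FM.mono (MTree.corolla g (Equiv.swap 0 1)) ∈
      relIdeal ε R (Fin 2) :=
  mem_idealGen.2 fun _ _ h2 _ => h2 ⟨g, rfl⟩

/-! ### Free algebras -/

/-- The free algebra on the set `Y` with binary operations `G`. -/
abbrev TM (k : Type u) [Field k] (G Y : Type) : Type u := BTree G Y →₀ k

variable {Y : Type}

/-- The class of a tree in the free algebra. -/
def TM.mono (t : BTree G Y) : TM k G Y := Finsupp.single t 1

/-- The operations of the free algebra. -/
def nodeOp (k : Type u) [Field k] {G Y : Type} (g : G) : TM k G Y →ₗ[k] TM k G Y →ₗ[k] TM k G Y :=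
  Finsupp.linearCombination k fun l => Finsupp.lmapDomain k k fun r => BTree.node g l r

@[simp]
theorem nodeOp_mono (g : G) (l r : BTree G Y) :
    nodeOp k g (TM.mono l) (TM.mono r) = TM.mono (.node g l r) := by
  simp [nodeOp, TM.mono]

theorem TM.hom_ext {P : Type*} [AddCommMonoid P] [Module k P] {φ ψ : TM k G Y →ₗ[k] P}
    (h : ∀ t, φ (mono t) = ψ (mono t)) : φ = ψ := by
  ext t
  exact h t

theorem BTree.eval_nodeOp (t : BTree G B) (u : B → BTree G Y) :
    t.eval (nodeOp k) (fun b => TM.mono (u b)) = TM.mono (t.bind u) := by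
  induction t with
  | leaf b => rfl
  | node g l r hl hr => simp [eval, bind, hl, hr]

/-- The relations of the free algebra on `Y` over the operad presented by `ε` and `R`. -/
def treeIdeal (ε : G → ℤˣ) (R : Set (FM k G (Fin 3))) (Y : Type) : Submodule k (TM k G Y) :=
  Submodule.span k {z | ∃ (B : Type) (_ : Finite B), ∃ x ∈ relIdeal ε R B, ∃ v : B → TM k G Y,
    z = FM.evalAt (nodeOp k) v x}

variable {ε : G → ℤˣ} {R : Set (FM k G (Fin 3))}

theorem evalAt_mem_treeIdeal [Finite B] {x : FM k G B} (hx : x ∈ relIdeal ε R B)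
    (v : B → TM k G Y) : FM.evalAt (nodeOp k) v x ∈ treeIdeal ε R Y :=
  Submodule.subset_span ⟨B, ‹_›, x, hx, v, rfl⟩

/-- The tree without vertices. -/
def MTree.one (G : Type) {A : Type} (a : A) (ha : ∀ b, b = a) : MTree G A :=
  ⟨.leaf a, by simp [BTree.leaves], fun b => by simp [BTree.leaves, ha b]⟩

/-- Grafting an element of an operad ideal on the first input of a (possibly transposed)
corolla. -/
theorem exists_graft {x : FM k G B} [Finite B] (hx : x ∈ relIdeal ε R B) (g : G)
    (σ : Equiv.Perm (Fin 2)) :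
    ∃ z ∈ relIdeal ε R (Option B), ∀ (v : B → TM k G Y) (y : TM k G Y),
      FM.evalAt (nodeOp k) (fun o => Option.elim o y v) z =
        FM.evalAt (nodeOp k) ![FM.evalAt (nodeOp k) v x, y] (FM.mono (MTree.corolla g σ)) := by
  let f : Option B → Fin 2 := fun o => Option.elim o 1 fun _ => 0
  let e : B ≃ Fib f 0 :=
    { toFun := fun b => ⟨some b, rfl⟩
      invFun := fun o => match o with
        | ⟨some b, _⟩ => b
        | ⟨none, h⟩ => absurd h (by simp [f])
      left_inv := fun b => rfl
      right_inv := by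
        rintro ⟨_ | b, h⟩
        · simp [f] at h
        · rfl }
  let w : ∀ i, FM k G (Fib f i) := fun i => match i with
    | 0 => FM.relabel e x
    | 1 => FM.mono (MTree.one G ⟨none, rfl⟩ (by rintro ⟨_ | b, h⟩ <;> simp [f] at h ⊢))
  refine ⟨FM.comp f (FM.mono (MTree.corolla g σ)) w, ?_, fun v y => ?_⟩
  · refine (isOperadIdeal_idealGen _ _).comp_right f _ w 0 ?_
    exact (isOperadIdeal_idealGen _ _).relabel e x hx
  · rw [FM.evalAt_comp]
    congr 2
    funext i
    fin_cases i
    · simp [w, FM.evalAt_relabel, e]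
    · exact FM.evalAt_mono _ _ _

/-- `treeIdeal` is only a span of values of relations. It absorbs the operations because grafting a
relation on an input of a corolla gives a relation with one more input; the transposed corolla
handles the other side. -/
theorem nodeOp_mem_left (g : G) (x y : TM k G Y) (hx : x ∈ treeIdeal ε R Y) :
    nodeOp k g x y ∈ treeIdeal ε R Y := by
  refine (Submodule.span_le (p := (treeIdeal ε R Y).comap ((nodeOp k g).flip y))).2 ?_ hx
  rintro _ ⟨B, _, x, hx, v, rfl⟩
  obtain ⟨z, hz, h⟩ := exists_graft (Y := Y) hx g 1
  have := evalAt_mem_treeIdeal hz fun o => Option.elim o y v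
  rw [h] at this
  simpa [BTree.eval] using this

theorem nodeOp_mem_right (g : G) (x y : TM k G Y) (hy : y ∈ treeIdeal ε R Y) :
    nodeOp k g x y ∈ treeIdeal ε R Y := by
  refine (Submodule.span_le (p := (treeIdeal ε R Y).comap (nodeOp k g x))).2 ?_ hy
  rintro _ ⟨B, _, y, hy, v, rfl⟩
  obtain ⟨z, hz, h⟩ := exists_graft (Y := Y) hy g (Equiv.swap 0 1)
  have := evalAt_mem_treeIdeal hz fun o => Option.elim o x v
  rw [h] at this
  simpa [BTree.eval] using this

/-- The multilinear part, with respect to an injection `j`, of an element of a free algebra. -/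
def multilinearPart (k : Type u) [Field k] (G : Type) {C Y : Type} (j : C → Y)
    (hj : Function.Injective j) : TM k G Y →ₗ[k] FM k G C :=
  Finsupp.lcomapDomain (MTree.mapTree j) (MTree.mapTree_injective hj)

/-! ### From relations in a free algebra back to relations in the operad -/

variable {j : C → Y}

theorem multilinearPart_map (hj : Function.Injective j) (t : MTree G C) :
    multilinearPart k G j hj (TM.mono (t.1.map j)) = FM.mono t :=
  Finsupp.comapDomain_single _ t 1 (MTree.mapTree_injective hj).injOn

theorem multilinearPart_eq_zero (hj : Function.Injective j) {t : BTree G Y}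
    (h : ∀ c : MTree G C, t ≠ c.1.map j) :
    multilinearPart k G j hj (TM.mono t) = 0 := by
  ext s
  exact Finsupp.single_eq_of_ne (h s).symm

/-- A family of trees, jointly with each label in the image of `j` exactly once, is a family of
tree monomials on the fibres of a map. -/
theorem exists_fib_of_leaves (hj : Function.Injective j) (l : List B) (hl : ∀ b, b ∈ l)
    (u : B → BTree G Y) (hnd : (l.flatMap fun b => (u b).leaves).Nodup)
    (hu : ∀ y, y ∈ (l.flatMap fun b => (u b).leaves) ↔ ∃ a, j a = y) :
    ∃ (f : C → B) (w : ∀ b, MTree G (Fib f b)), ∀ b, u b = (w b).1.map fun a => j a.1 := by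
  rw [List.nodup_flatMap] at hnd
  have hmem : ∀ a, ∃ b, j a ∈ (u b).leaves := fun a => by
    have := (hu (j a)).2 ⟨a, rfl⟩
    rw [List.mem_flatMap] at this
    exact ⟨this.choose, this.choose_spec.2⟩
  choose f hf using hmem
  have huniq : ∀ a b, j a ∈ (u b).leaves → f a = b := by
    intro a b hab
    by_contra hne
    have : Std.Symm (Function.onFun List.Disjoint fun b => (u b).leaves) :=
      ⟨fun x y hxy => hxy.symm⟩
    exact hnd.2.forall (hl (f a)) (hl b) hne (hf a) hab
  have hex : ∀ b, ∃ w : BTree G (Fib f b), w.map (fun a => j a.1) = u b := by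
    intro b
    refine BTree.exists_map_eq _ _ fun y hy => ?_
    obtain ⟨a, rfl⟩ := (hu y).1 (List.mem_flatMap.2 ⟨b, hl b, hy⟩)
    exact ⟨⟨a, huniq a b hy⟩, rfl⟩
  choose w hw using hex
  refine ⟨f, fun b => ⟨w b, ?_, fun a => ?_⟩, fun b => (hw b).symm⟩
  · have := hnd.1 b (hl b)
    rw [← hw b, BTree.leaves_map] at this
    exact this.of_map
  · obtain ⟨a, rfl⟩ := a
    have := hf a
    rw [← hw (f a), BTree.leaves_map, List.mem_map] at this
    obtain ⟨a', ha', h'⟩ := this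
    obtain rfl : a' = ⟨a, rfl⟩ := Subtype.ext (hj h')
    exact ha'

/-- The multilinear relations of a free algebra are relations of the operad. -/
theorem multilinearPart_mem (hj : Function.Injective j) {z : TM k G Y} (hz : z ∈ treeIdeal ε R Y) :
    multilinearPart k G j hj z ∈ relIdeal ε R C := by
  classical
  refine (Submodule.span_le (p := (relIdeal ε R C).comap (multilinearPart k G j hj))).2 ?_ hz
  rintro _ ⟨B, _, x, hx, v, rfl⟩
  rw [SetLike.mem_coe, Submodule.mem_comap, ← Submodule.Quotient.mk_eq_zero, ← FM.eval_apply,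
    ← Submodule.mkQ_apply]
  -- Values of x are multilinear in the labels, so it is enough to substitute trees for the inputs.
  have key : ((relIdeal ε R C).mkQ ∘ₗ multilinearPart k G j hj).compMultilinearMap
      (FM.eval (nodeOp k) x) = 0 := by
    refine Module.Basis.ext_multilinear (fun b => Finsupp.basisSingleOne) fun u => ?_
    have h1 : ∀ s, (Finsupp.basisSingleOne s : TM k G Y) = TM.mono s := fun s => by
      simp [TM.mono]
    simp only [LinearMap.compMultilinearMap_apply, h1, FM.eval_apply, LinearMap.comp_apply,
      zero_apply]
    rw [Submodule.mkQ_apply, Submodule.Quotient.mk_eq_zero]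
    -- Whether a substitution is multilinear depends only on the substituted trees u. If one tree
    -- monomial t₀ becomes multilinear, then u is a family of tree monomials on the fibres of a map
    -- f, and substitution is operadic composition along f. Otherwise every multilinear part
    -- vanishes.
    by_cases hu : ∃ (t₀ : MTree G B) (c : MTree G C), t₀.1.bind u = c.1.map j
    · obtain ⟨t₀, c, h⟩ := hu
      have hl := congrArg BTree.leaves h
      rw [BTree.leaves_bind, BTree.leaves_map] at hl
      obtain ⟨f, w, hw⟩ := exists_fib_of_leaves hj t₀.1.leaves t₀.2.2 u
        (hl ▸ c.2.1.map hj) fun y => by simp [hl, c.2.2]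
      have : ∀ y : FM k G B, multilinearPart k G j hj
          (FM.evalAt (nodeOp k) (fun b => TM.mono (u b)) y) =
            FM.comp f y fun b => FM.mono (w b) := by
        intro y
        induction y using Finsupp.induction_linear with
        | zero => simp
        | add y y' hy hy' => simp [hy, hy']
        | single t c =>
          have hc : (Finsupp.single t c : FM k G B) = c • FM.mono t := by simp [FM.mono]
          have hb : t.1.bind u = (MTree.comp f t w).1.map j := by
            simp only [MTree.comp_val, BTree.map_bind, BTree.map_map]
            exact congrArg _ (funext hw)
          rw [hc]
          simp only [map_smul, smul_apply, FM.comp_mono, FM.evalAt_mono, BTree.eval_nodeOp, hb,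
            multilinearPart_map]
      rw [this]
      exact (isOperadIdeal_idealGen _ _).comp_left f x _ hx
    · push Not at hu
      have : multilinearPart k G j hj ∘ₗ FM.evalAt (nodeOp k) (fun b => TM.mono (u b)) = 0 :=
        FM.hom_ext fun t => by
          simp [BTree.eval_nodeOp, multilinearPart_eq_zero hj (hu t)]
      rw [← LinearMap.comp_apply, this]
      exact zero_mem _
  exact congrArg (fun m => m v) key

end

section

variable {k : Type u} [Field k] {G A B Y : Type}

theorem multilinearPart_id (t : MTree G A) :
    multilinearPart k G (fun a : A => a) (fun _ _ h => h) (TM.mono t.1) = FM.mono t := by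
  have := multilinearPart_map (k := k) (j := fun a : A => a) (fun _ _ h => h) t
  rwa [BTree.map_id] at this

/-! ### Tree monomials in the operad of commutative associative algebras -/

theorem treeIdeal_com_comm (l r : BTree Unit Y) :
    TM.mono (.node () l r) - TM.mono (.node () r l) ∈ treeIdeal comSign (comRel k) Y := by
  have := evalAt_mem_treeIdeal (corolla_mem_relIdeal comSign (comRel k) ())
    ![TM.mono l, TM.mono r]
  simpa [BTree.eval, comSign] using this

theorem treeIdeal_com_assoc (t₀ t₁ t₂ : BTree Unit Y) :
    TM.mono (.node () (.node () t₀ t₁) t₂) - TM.mono (.node () t₀ (.node () t₁ t₂)) ∈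
      treeIdeal comSign (comRel k) Y := by
  have := evalAt_mem_treeIdeal (mem_relIdeal_of_mem (ε := comSign) (R := comRel k) rfl)
    ![TM.mono t₀, TM.mono t₁, TM.mono t₂]
  simpa [BTree.eval] using this

/-- Equality of trees in the free commutative associative algebra. -/
def comSetoid (k : Type u) [Field k] (Y : Type) : Setoid (BTree Unit Y) where
  r s t := TM.mono s - TM.mono t ∈ treeIdeal comSign (comRel k) Y
  iseqv :=
    { refl := fun s => by simp
      symm := fun {s t} h => by simpa using neg_mem h
      trans := fun {s t r} h h' => by simpa using add_mem h h' }

/-- The commutative semigroup of trees in the free commutative associative algebra. -/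
def ComSemigroup (k : Type u) [Field k] (Y : Type) : Type := Quotient (comSetoid k Y)

instance : CommSemigroup (ComSemigroup k Y) where
  mul := Quotient.map₂ (BTree.node ()) fun s s' h t t' h' => by
    have h1 := nodeOp_mem_left () _ (TM.mono t) h
    have h2 := nodeOp_mem_right () (TM.mono s') _ h'
    simp only [map_sub, LinearMap.sub_apply, nodeOp_mono] at h1 h2
    have h3 := add_mem h1 h2
    rwa [sub_add_sub_cancel] at h3
  mul_assoc := by
    rintro ⟨a⟩ ⟨b⟩ ⟨c⟩
    exact Quotient.sound (treeIdeal_com_assoc a b c)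
  mul_comm := by
    rintro ⟨a⟩ ⟨b⟩
    exact Quotient.sound (treeIdeal_com_comm a b)

/-- The class of a tree in the free commutative associative algebra. -/
def ComSemigroup.mk (k : Type u) [Field k] (t : BTree Unit Y) : ComSemigroup k Y :=
  Quotient.mk (comSetoid k Y) t

/-- The unit is adjoined so that products over lists make sense. In a commutative monoid such a
product is invariant under permutation, so the class of a tree depends only on the multiset of its
leaves. -/
theorem ComSemigroup.coe_mk_eq_prod (t : BTree Unit Y) :
    (ComSemigroup.mk k t : WithOne (ComSemigroup k Y)) =
      (t.leaves.map fun a => (ComSemigroup.mk k (.leaf a) : WithOne (ComSemigroup k Y))).prod := by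
  induction t with
  | leaf a => simp [BTree.leaves]
  | node g l r hl hr =>
    rw [BTree.leaves, List.map_append, List.prod_append, ← hl, ← hr, ← WithOne.coe_mul]
    rfl

/-- Any two tree monomials of the same arity agree in the operad of commutative associative
algebras. -/
theorem com_mono_sub_mem (s t : MTree Unit A) :
    FM.mono s - FM.mono t ∈ relIdeal comSign (comRel k) A := by
  have hp : s.1.leaves.Perm t.1.leaves :=
    (List.perm_ext_iff_of_nodup s.2.1 t.2.1).2 fun a => by simp [s.2.2 a, t.2.2 a]
  have h : ComSemigroup.mk k s.1 = ComSemigroup.mk k t.1 := by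
    rw [← WithOne.coe_inj, ComSemigroup.coe_mk_eq_prod, ComSemigroup.coe_mk_eq_prod]
    exact (hp.map _).prod_eq
  have h' : TM.mono s.1 - TM.mono t.1 ∈ treeIdeal comSign (comRel k) A := Quotient.exact h
  have := multilinearPart_mem (j := fun a : A => a) (fun _ _ h => h) h'
  rwa [map_sub, multilinearPart_id, multilinearPart_id] at this

theorem exists_leaves_eq (g : G) (l : List A) (hl : l ≠ []) : ∃ t : BTree G A, t.leaves = l := by
  induction l with
  | nil => exact absurd rfl hl
  | cons a l ih =>
    rcases eq_or_ne l [] with rfl | h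
    · exact ⟨.leaf a, rfl⟩
    · obtain ⟨t, rfl⟩ := ih h
      exact ⟨.node g (.leaf a) t, rfl⟩

theorem MTree.nonempty (g : G) [Finite A] [Nonempty A] : Nonempty (MTree G A) := by
  have := Fintype.ofFinite A
  obtain ⟨t, ht⟩ := exists_leaves_eq g (Finset.univ : Finset A).toList
    (by simpa using Finset.univ_nonempty.ne_empty)
  exact ⟨t, by rw [ht]; exact Finset.nodup_toList _, fun a => by simp [ht]⟩

/-- The operad of commutative associative algebras is spanned in each arity by any tree
monomial. -/
theorem com_eq_smul_mk (c : MTree Unit A) (x : QuadOp comSign (comRel k) A) :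
    ∃ r : k, x = r • QuadOp.mk comSign (comRel k) (FM.mono c) := by
  obtain ⟨x, rfl⟩ := Submodule.mkQ_surjective _ x
  induction x using Finsupp.induction_linear with
  | zero => exact ⟨0, by simp⟩
  | add x y hx hy =>
    obtain ⟨a, ha⟩ := hx
    obtain ⟨b, hb⟩ := hy
    exact ⟨a + b, by rw [map_add, ha, hb, add_smul]⟩
  | single t r =>
    refine ⟨r, ?_⟩
    have : (Finsupp.single t r : FM k Unit A) = r • FM.mono t := by simp [FM.mono]
    rw [this, map_smul]
    congr 1
    rw [← sub_eq_zero, ← map_sub, Submodule.mkQ_apply, Submodule.Quotient.mk_eq_zero]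
    exact com_mono_sub_mem t c

/-! ### Composites of tree monomials as values of `xi` -/

section Xi

variable {G₁ G₂ : Type} {ε₁ : G₁ → ℤˣ} {ε₂ : G₂ → ℤˣ} (R₁ : Set (FM k G₁ (Fin 3)))
  (R₂ : Set (FM k G₂ (Fin 3))) (D : F12 k ε₁ ε₂ →ₗ[k] F21 k ε₁ ε₂)

/-- The composite of a tree with vertices in `G₂` and trees with vertices in `G₁`. -/
def stack (f : A → B) (T : MTree G₂ B) (w : ∀ b, MTree G₁ (Fib f b)) : MTree (G₁ ⊕ G₂) A :=
  MTree.comp f (T.mapGen Sum.inr) fun b => (w b).mapGen Sum.inl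

open Classical in
theorem xi_lof_mono [Finite A] (s : Setoid A) (T : MTree G₂ (Quotient s))
    (w : ∀ q, MTree G₁ (Fib (Quotient.mk s) q)) :
    xi R₁ R₂ D A (DirectSum.lof k (Setoid A)
      (fun s => QuadOp ε₂ R₂ (Quotient s) ⊗[k]
        PiTensorProduct k fun q : Quotient s => QuadOp ε₁ R₁ (Fib (Quotient.mk s) q)) s
      (QuadOp.mk ε₂ R₂ (FM.mono T) ⊗ₜ[k]
        PiTensorProduct.tprod k fun q => QuadOp.mk ε₁ R₁ (FM.mono (w q)))) =
    QuadOp.mk _ _ (FM.mono (stack (Quotient.mk s) T w)) := by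
  rw [xi_apply]
  simp only [incl₁, incl₂, QuadOp.mapGen, QuadOp.mk, Submodule.mkQ_apply, Submodule.mapQ_apply,
    FM.mapGen_mono]
  refine (QuadOp.comp_mk _ _ _).trans ?_
  rw [FM.comp_mono]
  rfl

variable (f : A → B) (hf : Function.Surjective f)

/-- The fibres of `f`, as blocks of the partition of its source. -/
def fibEquiv (q : Quotient (Setoid.ker f)) :
    Fib f (Setoid.quotientKerEquivOfSurjective f hf q) ≃
      Fib (Quotient.mk (Setoid.ker f)) q :=
  Equiv.subtypeEquivRight fun a => by
    rw [← (Setoid.quotientKerEquivOfSurjective f hf).apply_eq_iff_eq]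
    rfl

/-- The tensor corresponding to a composite along a surjection. -/
def stackTensor (T : MTree G₂ B) (w : ∀ b, MTree G₁ (Fib f b)) :
    QuadOp ε₂ R₂ (Quotient (Setoid.ker f)) ⊗[k]
      PiTensorProduct k fun q : Quotient (Setoid.ker f) =>
        QuadOp ε₁ R₁ (Fib (Quotient.mk (Setoid.ker f)) q) :=
  QuadOp.mk ε₂ R₂ (FM.mono (T.map (Setoid.quotientKerEquivOfSurjective f hf).symm)) ⊗ₜ[k]
    PiTensorProduct.tprod k fun q => QuadOp.mk ε₁ R₁
      (FM.mono ((w (Setoid.quotientKerEquivOfSurjective f hf q)).map (fibEquiv f hf q)))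

-- The summands of the composite are indexed by equivalence relations, while explicit composites
-- come from surjections. Identifying the target of f with the quotient by its kernel does not
-- change the grafted tree.
open Classical in
theorem xi_stackTensor [Finite A] (T : MTree G₂ B) (w : ∀ b, MTree G₁ (Fib f b)) :
    xi R₁ R₂ D A (DirectSum.lof k (Setoid A)
      (fun s => QuadOp ε₂ R₂ (Quotient s) ⊗[k]
        PiTensorProduct k fun q : Quotient s => QuadOp ε₁ R₁ (Fib (Quotient.mk s) q)) _
      (stackTensor R₁ R₂ f hf T w)) = QuadOp.mk _ _ (FM.mono (stack f T w)) := by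
  rw [stackTensor, xi_lof_mono]
  congr 2
  refine Subtype.ext ?_
  simp only [stack, MTree.comp_val, MTree.mapGen_val, MTree.map_val, BTree.mapGen_map,
    BTree.bind_map, BTree.map_map]
  refine congrArg _ (funext fun b => ?_)
  obtain ⟨q, rfl⟩ := (Setoid.quotientKerEquivOfSurjective f hf).surjective b
  rw [Equiv.symm_apply_apply]
  rfl

end Xi

/-! ### The trivial law: surjectivity -/

theorem mem_combinedRel_zero {R₁ R₂ : Set (FM k Unit (Fin 3))} {ε₁ ε₂ : Unit → ℤˣ}
    {x : FM k (Unit ⊕ Unit) (Fin 3)}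
    (hx : QuadOp.mk (Sum.elim ε₁ ε₂) ∅ x ∈ F12 k ε₁ ε₂) :
    x ∈ combinedRel R₁ R₂ (0 : F12 k ε₁ ε₂ →ₗ[k] F21 k ε₁ ε₂) :=
  Or.inr ⟨⟨_, hx⟩, by simp⟩

theorem lcomb_mem_F12 (ε₁ ε₂ : Unit → ℤˣ) (σ : Equiv.Perm (Fin 3)) :
    QuadOp.mk (Sum.elim ε₁ ε₂) ∅ (FM.mono (MTree.lcomb (.inl ()) (.inr ()) σ)) ∈ F12 k ε₁ ε₂ :=
  Submodule.subset_span ⟨_, ⟨(), rfl⟩, _, ⟨(), rfl⟩, σ, Or.inl rfl⟩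

theorem rcomb_mem_F12 (ε₁ ε₂ : Unit → ℤˣ) (σ : Equiv.Perm (Fin 3)) :
    QuadOp.mk (Sum.elim ε₁ ε₂) ∅ (FM.mono (MTree.rcomb (.inl ()) (.inr ()) σ)) ∈ F12 k ε₁ ε₂ :=
  Submodule.subset_span ⟨_, ⟨(), rfl⟩, _, ⟨(), rfl⟩, σ, Or.inr rfl⟩

/-- The tree with vertices in `G₁ ⊕ G₂` obtained from a tree of trees. -/
def BTree.expand {G₁ G₂ : Type} (T : BTree G₂ (BTree G₁ A)) : BTree (G₁ ⊕ G₂) A :=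
  (T.mapGen Sum.inr).bind fun c => c.mapGen Sum.inl

/-- The trivial law makes an `inl` vertex directly above an `inr` vertex a relation. A tree without
such a configuration has all its `inr` vertices at the top, with trees of `inl` vertices grafted
below. -/
theorem eq_expand_or_mem_treeIdeal (R₁ R₂ : Set (FM k Unit (Fin 3))) (ε₁ ε₂ : Unit → ℤˣ)
    (t : BTree (Unit ⊕ Unit) A) :
    (∃ T : BTree Unit (BTree Unit A), T.expand = t) ∨
      TM.mono t ∈ treeIdeal (Sum.elim ε₁ ε₂)
        (combinedRel R₁ R₂ (0 : F12 k ε₁ ε₂ →ₗ[k] F21 k ε₁ ε₂)) A := by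
  induction t with
  | leaf a => exact Or.inl ⟨.leaf (.leaf a), rfl⟩
  | node g l r hl hr =>
    rcases hl with ⟨T, rfl⟩ | hl
    swap
    · exact Or.inr (by simpa using nodeOp_mem_left g _ (TM.mono r) hl)
    rcases hr with ⟨T', rfl⟩ | hr
    swap
    · exact Or.inr (by simpa using nodeOp_mem_right g (TM.mono T.expand) _ hr)
    rcases g with ⟨⟩ | ⟨⟩
    swap
    · exact Or.inl ⟨.node () T T', rfl⟩
    rcases T with c | ⟨⟨⟩, T₀, T₁⟩
    swap
    · right
      have := evalAt_mem_treeIdeal (mem_relIdeal_of_mem (ε := Sum.elim ε₁ ε₂)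
        (mem_combinedRel_zero (R₁ := R₁) (R₂ := R₂) (lcomb_mem_F12 (k := k) ε₁ ε₂ 1)))
        ![TM.mono T₀.expand, TM.mono T₁.expand, TM.mono T'.expand]
      simp only [FM.evalAt_mono, MTree.lcomb_val, BTree.eval] at this
      simp only [Equiv.Perm.one_apply, Matrix.cons_val, nodeOp_mono] at this
      exact this
    rcases T' with c' | ⟨⟨⟩, T₀, T₁⟩
    swap
    · right
      have := evalAt_mem_treeIdeal (mem_relIdeal_of_mem (ε := Sum.elim ε₁ ε₂)
        (mem_combinedRel_zero (R₁ := R₁) (R₂ := R₂) (rcomb_mem_F12 (k := k) ε₁ ε₂ 1)))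
        ![TM.mono (BTree.leaf c).expand, TM.mono T₀.expand, TM.mono T₁.expand]
      simp only [FM.evalAt_mono, MTree.rcomb_val, BTree.eval] at this
      simp only [Equiv.Perm.one_apply, Matrix.cons_val, nodeOp_mono] at this
      exact this
    exact Or.inl ⟨.leaf (.node () c c'), rfl⟩

/-- The indexing set B is the set of leaves of T, which are themselves trees. None of them occurs
twice, since each has a leaf and the labels of t are distinct; f sends a label to the leaf of T
containing it. -/
theorem exists_stack_eq {G₁ G₂ : Type} (t : MTree (G₁ ⊕ G₂) A) (T : BTree G₂ (BTree G₁ A))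
    (h : T.expand = t.1) :
    ∃ (B : Type) (f : A → B) (_ : Function.Surjective f) (T' : MTree G₂ B)
      (w : ∀ b, MTree G₁ (Fib f b)), stack f T' w = t := by
  obtain ⟨T', hT'⟩ : ∃ T' : BTree G₂ {c // c ∈ T.leaves}, T'.map Subtype.val = T :=
    BTree.exists_map_eq _ _ fun c hc => ⟨⟨c, hc⟩, rfl⟩
  have hl : (T.leaves.flatMap BTree.leaves) = t.1.leaves := by
    rw [← h, BTree.expand, BTree.leaves_bind, BTree.leaves_mapGen]
    simp only [BTree.leaves_mapGen]
  have hl' : T'.leaves.map Subtype.val = T.leaves := by rw [← BTree.leaves_map, hT']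
  have hnd : T.leaves.Nodup := by
    have := t.2.1
    rw [← hl, List.nodup_flatMap] at this
    refine this.2.imp fun {c d} hcd hne => ?_
    subst hne
    obtain ⟨a, ha⟩ := List.exists_mem_of_ne_nil _ c.leaves_ne_nil
    exact hcd ha ha
  have hnd' : T'.leaves.Nodup := by
    rw [← hl'] at hnd
    exact hnd.of_map
  have hmem : ∀ c, c ∈ T'.leaves := fun c => by
    obtain ⟨d, hd, hdc⟩ := List.mem_map.1 (show c.1 ∈ T'.leaves.map Subtype.val by rw [hl']; exact c.2)
    rwa [← Subtype.ext hdc]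
  have hb : (T'.leaves.flatMap fun c => c.1.leaves) = t.1.leaves := by
    rw [← hl]
    conv_rhs => rw [← hT', BTree.leaves_map, List.flatMap_map]
  obtain ⟨f, w, hw⟩ := exists_fib_of_leaves (j := fun a : A => a) (fun _ _ h => h) T'.leaves hmem
    Subtype.val (hb ▸ t.2.1) fun a => by simp [hb, t.2.2]
  refine ⟨_, f, fun c => ?_, ⟨T', hnd', hmem⟩, w, Subtype.ext ?_⟩
  · obtain ⟨a, -⟩ := List.exists_mem_of_ne_nil _ (w c).1.leaves_ne_nil
    exact ⟨a.1, a.2⟩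
  · rw [← h]
    conv_rhs => rw [← hT']
    simp only [stack, BTree.expand, MTree.comp_val, MTree.mapGen_val, BTree.mapGen_map,
      BTree.bind_map]
    refine congrArg _ (funext fun c => ?_)
    rw [hw c, BTree.mapGen_map]

theorem xi_zero_surjective (R₁ R₂ : Set (FM k Unit (Fin 3))) (ε₁ ε₂ : Unit → ℤˣ) [Finite A] :
    Function.Surjective (xi R₁ R₂ (0 : F12 k ε₁ ε₂ →ₗ[k] F21 k ε₁ ε₂) A) := by
  rw [← LinearMap.range_eq_top, Submodule.eq_top_iff']
  intro x
  obtain ⟨x, rfl⟩ := Submodule.mkQ_surjective _ x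
  induction x using Finsupp.induction_linear with
  | zero => simp
  | add x y hx hy => rw [map_add]; exact add_mem hx hy
  | single t r =>
    have : (Finsupp.single t r : FM k (Unit ⊕ Unit) A) = r • FM.mono t := by simp [FM.mono]
    rw [this, map_smul]
    refine Submodule.smul_mem _ _ ?_
    rcases eq_expand_or_mem_treeIdeal R₁ R₂ ε₁ ε₂ t.1 with ⟨T, hT⟩ | h
    · obtain ⟨B, f, hf, T', w, rfl⟩ := exists_stack_eq t T hT
      exact ⟨_, xi_stackTensor R₁ R₂ 0 f hf T' w⟩
    · have := multilinearPart_mem (j := fun a : A => a) (fun _ _ h => h) h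
      rw [multilinearPart_id] at this
      rw [Submodule.mkQ_apply, (Submodule.Quotient.mk_eq_zero _).2 this]
      exact zero_mem _

end

section

variable {k : Type u} [Field k] {G A B Y : Type} {M : Type*} [AddCommGroup M] [Module k M]

/-! ### The trivial law: injectivity -/

theorem eval_zero_node (v : A → M) (g : G) (l r : BTree G A) :
    (BTree.node g l r).eval (0 : G → M →ₗ[k] M →ₗ[k] M) v = 0 := by
  simp [BTree.eval]

/-- A tree with three leaves has a vertex, and every operation is zero. -/
theorem evalAt_zero_three (v : Fin 3 → M) (x : FM k G (Fin 3)) :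
    FM.evalAt (0 : G → M →ₗ[k] M →ₗ[k] M) v x = 0 := by
  have : FM.evalAt (k := k) (0 : G → M →ₗ[k] M →ₗ[k] M) v = 0 := FM.hom_ext fun t => by
    rw [FM.evalAt_mono]
    obtain ⟨a | ⟨g, l, r⟩, ht⟩ := t
    · have h0 := ht.2 0
      have h1 := ht.2 1
      simp only [BTree.leaves, List.mem_singleton] at h0 h1
      exact absurd (h0.trans h1.symm) (by decide)
    · exact eval_zero_node _ _ _ _
  rw [this, LinearMap.zero_apply]

/-- A linear map which vanishes on decomposable elements vanishes on the relations. -/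
theorem eq_zero_of_mem_treeIdeal {ε : G → ℤˣ} {R : Set (FM k G (Fin 3))} (q : TM k G Y →ₗ[k] M)
    (hq : ∀ g x y, q (nodeOp k g x y) = 0) {z : TM k G Y} (hz : z ∈ treeIdeal ε R Y) :
    q z = 0 := by
  refine (Submodule.span_le (p := LinearMap.ker q)).2 ?_ hz
  rintro _ ⟨B, _, x, hx, v, rfl⟩
  -- The hypothesis says that q is a morphism of algebras to M with zero operations, and all
  -- defining relations hold there.
  have h1 : q ∘ₗ FM.evalAt (nodeOp k) v = FM.evalAt 0 fun b => q (v b) := FM.hom_ext fun t => by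
    rw [LinearMap.comp_apply, FM.evalAt_mono, FM.evalAt_mono]
    cases t.1 with
    | leaf a => rfl
    | node g l r => rw [eval_zero_node, BTree.eval, hq]
  have h2 : relIdeal ε R B ≤ FM.evalIdeal (0 : G → M →ₗ[k] M →ₗ[k] M) ⊥ B :=
    FM.relIdeal_le_evalIdeal _ (by simp) (by simp) (by simp)
      fun x _ v => by rw [evalAt_zero_three]; exact zero_mem _
  have h3 := (FM.mem_evalIdeal _).1 (h2 hx) fun b => q (v b)
  rw [← h1] at h3
  exact h3

/-- The product of two trees: the union of the labels for trees without vertices. -/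
def joinTree (k : Type u) [Field k] {G A : Type} :
    BTree G (Set A) → BTree G (Set A) → TM k G (Set A)
  | .leaf S, .leaf T => TM.mono (.leaf (S ∪ T))
  | _, _ => 0

/-- The commutative associative product of the free Lie algebra on a commutative semigroup for
which products with brackets vanish. -/
def joinOp (k : Type u) [Field k] (G A : Type) :
    TM k G (Set A) →ₗ[k] TM k G (Set A) →ₗ[k] TM k G (Set A) :=
  Finsupp.linearCombination k fun l => Finsupp.linearCombination k fun r => joinTree k l r

@[simp]
theorem joinOp_mono (l r : BTree G (Set A)) :
    joinOp k G A (TM.mono l) (TM.mono r) = joinTree k l r := by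
  simp [joinOp, TM.mono]

theorem joinOp_comm (x y : TM k G (Set A)) : joinOp k G A x y = joinOp k G A y x := by
  have : joinOp k G A = (joinOp k G A).flip :=
    TM.hom_ext fun s => TM.hom_ext fun t => by
      rw [LinearMap.flip_apply, joinOp_mono, joinOp_mono]
      rcases s with S | ⟨g, l, r⟩ <;> rcases t with T | ⟨h, l', r'⟩ <;>
        simp [joinTree, Set.union_comm]
  exact LinearMap.congr_fun (LinearMap.congr_fun this x) y

theorem joinOp_node (g : G) (x y z : TM k G (Set A)) :
    joinOp k G A (nodeOp k g x y) z = 0 := by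
  have : (nodeOp k g).compr₂ (joinOp k G A) = 0 :=
    TM.hom_ext fun s => TM.hom_ext fun t => TM.hom_ext fun r => by
      rw [LinearMap.compr₂_apply, nodeOp_mono, joinOp_mono]
      cases r <;> rfl
  exact LinearMap.congr_fun (LinearMap.congr_fun (LinearMap.congr_fun this x) y) z

theorem joinOp_assoc (x y z : TM k G (Set A)) :
    joinOp k G A (joinOp k G A x y) z = joinOp k G A x (joinOp k G A y z) := by
  have hs : ∀ (t : BTree G (Set A)) (c : k),
      (Finsupp.single t c : TM k G (Set A)) = c • TM.mono t := fun t c => by simp [TM.mono]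
  induction x using Finsupp.induction_linear with
  | zero => simp
  | add x x' hx hx' => simp only [map_add, LinearMap.add_apply, hx, hx']
  | single s a =>
  induction y using Finsupp.induction_linear with
  | zero => simp
  | add y y' hy hy' => simp only [map_add, LinearMap.add_apply, hy, hy']
  | single t b =>
  induction z using Finsupp.induction_linear with
  | zero => simp
  | add z z' hz hz' => simp only [map_add, hz, hz']
  | single r c =>
    simp only [hs, map_smul, LinearMap.smul_apply, joinOp_mono]
    congr 3
    rcases s with S | ⟨g, s, s'⟩ <;> rcases t with T | ⟨g, t, t'⟩ <;>
      rcases r with R | ⟨g, r, r'⟩ <;> simp [joinTree, Set.union_assoc]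

/-- Multiplication by y kills every node, hence every relation. This is why the product descends to
the free Lie algebra. -/
theorem joinOp_eq_zero_left {ε : G → ℤˣ} {R : Set (FM k G (Fin 3))} {x : TM k G (Set A)}
    (hx : x ∈ treeIdeal ε R (Set A)) (y : TM k G (Set A)) : joinOp k G A x y = 0 :=
  eq_zero_of_mem_treeIdeal ((joinOp k G A).flip y) (fun g a b => joinOp_node g a b y) hx

/-- The commutative product and the bracket of the free algebra over the operad defined by the
trivial distributive law. -/
def modelOps (k : Type u) [Field k] (A : Type) :
    Unit ⊕ Unit → TM k Unit (Set A) →ₗ[k] TM k Unit (Set A) →ₗ[k] TM k Unit (Set A) :=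
  Sum.elim (fun _ => joinOp k Unit A) fun g => nodeOp k g

/-- The model is an algebra over the combined operad for D = 0: the commutative and associative laws
hold exactly, the Lie relations hold modulo N, and products with brackets vanish. -/
theorem relIdeal_le_evalIdeal_modelOps (Y : Type) :
    relIdeal (Sum.elim comSign lieSign) (combinedRel (comRel k) (lieRel k)
      (0 : F12 k comSign lieSign →ₗ[k] F21 k comSign lieSign)) A ≤
      FM.evalIdeal (modelOps k Y) (treeIdeal lieSign (lieRel k) (Set Y)) A := by
  set N := treeIdeal lieSign (lieRel k) (Set Y)
  have hl : ∀ g x y, x ∈ N → modelOps k Y g x y ∈ N := by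
    rintro (g | g) x y hx
    · rw [modelOps, Sum.elim_inl, joinOp_eq_zero_left hx]
      exact zero_mem _
    · exact nodeOp_mem_left g x y hx
  have hr : ∀ g x y, y ∈ N → modelOps k Y g x y ∈ N := by
    rintro (g | g) x y hy
    · rw [modelOps, Sum.elim_inl, joinOp_comm, joinOp_eq_zero_left hy]
      exact zero_mem _
    · exact nodeOp_mem_right g x y hy
  have hs : ∀ g x y, modelOps k Y g x y -
      (((Sum.elim comSign lieSign g : ℤˣ) : ℤ) : k) • modelOps k Y g y x ∈ N := by
    rintro (g | g) x y
    · simp [modelOps, comSign, joinOp_comm x y]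
    · have := evalAt_mem_treeIdeal (corolla_mem_relIdeal lieSign (lieRel k) g) ![x, y]
      simpa [BTree.eval, modelOps] using this
  refine FM.relIdeal_le_evalIdeal _ hl hr hs ?_
  rintro z ((⟨x, rfl, rfl⟩ | ⟨x, hx, rfl⟩) | ⟨x, hz⟩) v
  · simp [FM.evalAt_mapGen, BTree.eval, modelOps, joinOp_assoc]
  · rw [FM.evalAt_mapGen]
    exact evalAt_mem_treeIdeal (mem_relIdeal_of_mem hx) v
  · have h0 : relIdeal (k := k) (Sum.elim comSign lieSign) ∅ (Fin 3) ≤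
        FM.evalIdeal (modelOps k Y) N (Fin 3) :=
      FM.relIdeal_le_evalIdeal _ hl hr hs (by simp)
    -- A relation of the third kind is an arbitrary representative z of a class in `F12`. A
    -- representative w with values in N is found first; then z − w is a relation of the free
    -- operad, whose values also lie in N.
    have h1 : F12 k comSign lieSign ≤ (FM.evalIdeal (modelOps k Y) N (Fin 3)).map
        (QuadOp.mk (Sum.elim comSign lieSign) ∅) := by
      refine Submodule.span_le.2 ?_
      rintro _ ⟨_, ⟨g, rfl⟩, _, ⟨h, rfl⟩, σ, rfl | rfl⟩
      · refine ⟨_, (FM.mem_evalIdeal _).2 fun v => ?_, rfl⟩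
        simp [BTree.eval, modelOps, joinOp_node]
      · refine ⟨_, (FM.mem_evalIdeal _).2 fun v => ?_, rfl⟩
        have : joinOp k Unit Y (v (σ 0)) (nodeOp k h (v (σ 1)) (v (σ 2))) = 0 := by
          rw [joinOp_comm, joinOp_node]
        simp [BTree.eval, modelOps, this]
    obtain ⟨w, hw, hwx⟩ := h1 x.2
    have hzw : z - w ∈ relIdeal (k := k) (Sum.elim comSign lieSign) ∅ (Fin 3) := by
      rw [← Submodule.Quotient.mk_eq_zero, ← Submodule.mkQ_apply, map_sub, hz, hwx]
      simp
    have := add_mem (h0 hzw) hw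
    rw [sub_add_cancel] at this
    exact (FM.mem_evalIdeal _).1 this v

/-! ### Recovering the partition and the Lie factor from the model -/

theorem eval_joinOp (t : BTree Unit B) (e : B → A) :
    t.eval (fun _ => joinOp k Unit A) (fun b => TM.mono (.leaf {e b})) =
      TM.mono (.leaf {a | ∃ b ∈ t.leaves, e b = a}) := by
  induction t with
  | leaf b =>
    simp only [BTree.eval, BTree.leaves]
    congr 2
    ext a
    simp [eq_comm]
  | node g l r hl hr =>
    rw [BTree.eval, hl, hr, joinOp_mono, joinTree]
    congr 2
    ext a
    simp [BTree.leaves, or_and_right, exists_or]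

theorem BTree.bind_leaf (t : BTree G A) (e : A → B) : t.bind (fun a => leaf (e a)) = t.map e := by
  induction t with
  | leaf a => rfl
  | node g l r hl hr => simp [bind, map, hl, hr]

/-- The block of a partition, as a set. -/
def block (s : Setoid A) (q : Quotient s) : Set A := {a | Quotient.mk s a = q}

theorem block_injective (s : Setoid A) : Function.Injective (block s) := by
  intro q q' h
  obtain ⟨a, rfl⟩ := Quotient.exists_rep q
  have : a ∈ block s q' := h ▸ (rfl : a ∈ block s ⟦a⟧)
  exact this

theorem eq_of_block_eq {s s' : Setoid A} (h : ∀ q, ∃ q', block s' q' = block s q) : s = s' := by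
  ext a b
  obtain ⟨q, hq⟩ := h (Quotient.mk s b)
  have hb : b ∈ block s' q := by rw [hq]; rfl
  obtain rfl : Quotient.mk s' b = q := hb
  have : a ∈ block s' (Quotient.mk s' b) ↔ a ∈ block s (Quotient.mk s b) := by rw [hq]
  exact Quotient.eq.symm.trans (this.symm.trans Quotient.eq)

theorem evalAt_stack (s : Setoid A) (T : MTree Unit (Quotient s))
    (w : ∀ q, MTree Unit (Fib (Quotient.mk s) q)) :
    FM.evalAt (modelOps k A) (fun a => TM.mono (.leaf {a}))
      (FM.mono (stack (Quotient.mk s) T w)) = TM.mono (T.1.map (block s)) := by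
  rw [FM.evalAt_mono, stack, MTree.comp_val, BTree.eval_bind, MTree.mapGen_val, BTree.eval_mapGen]
  simp only [BTree.eval_map, MTree.mapGen_val, BTree.eval_mapGen]
  have : ∀ q, (w q).1.eval (fun h => modelOps k A (Sum.inl h))
      (fun a => TM.mono (.leaf {a.1})) = TM.mono (.leaf (block s q)) := by
    intro q
    refine (eval_joinOp _ _).trans ?_
    congr 2
    ext a
    exact ⟨by rintro ⟨b, -, rfl⟩; exact b.2, fun h => ⟨⟨a, h⟩, (w q).2.2 _, rfl⟩⟩
  simp only [this]
  rw [← BTree.bind_leaf]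
  exact BTree.eval_nodeOp _ _

/-- The component, for the partition `s`, of the value of an element of the combined operad in the
free algebra over the operad defined by the trivial distributive law. -/
def blockPart (s : Setoid A) : CombinedOp (comRel k) (lieRel k)
      (0 : F12 k comSign lieSign →ₗ[k] F21 k comSign lieSign) A →ₗ[k]
    QuadOp lieSign (lieRel k) (Quotient s) :=
  Submodule.mapQ _ _ (multilinearPart k Unit (block s) (block_injective s) ∘ₗ
    FM.evalAt (modelOps k A) fun a => TM.mono (.leaf {a})) fun _ hx =>
      multilinearPart_mem (block_injective s)
        ((FM.mem_evalIdeal _).1 (relIdeal_le_evalIdeal_modelOps A hx) _)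

theorem blockPart_stack_self (s : Setoid A) (T : MTree Unit (Quotient s))
    (w : ∀ q, MTree Unit (Fib (Quotient.mk s) q)) :
    blockPart s (QuadOp.mk _ _ (FM.mono (stack (Quotient.mk s) T w))) =
      QuadOp.mk lieSign (lieRel k) (FM.mono T) := by
  rw [blockPart, QuadOp.mk, Submodule.mkQ_apply, Submodule.mapQ_apply, LinearMap.comp_apply,
    evalAt_stack, multilinearPart_map]
  rfl

/-- The value is a Lie monomial whose leaves are exactly the blocks of s. Were it multilinear in the
blocks of s', each block of s would be one of s', forcing the partitions to agree. -/
theorem blockPart_stack_of_ne {s s' : Setoid A} (hs : s ≠ s') (T : MTree Unit (Quotient s))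
    (w : ∀ q, MTree Unit (Fib (Quotient.mk s) q)) :
    blockPart (k := k) s' (QuadOp.mk _ _ (FM.mono (stack (Quotient.mk s) T w))) = 0 := by
  rw [blockPart, QuadOp.mk, Submodule.mkQ_apply, Submodule.mapQ_apply, LinearMap.comp_apply,
    evalAt_stack, multilinearPart_eq_zero, Submodule.Quotient.mk_zero]
  intro c hc
  refine hs (eq_of_block_eq fun q => ?_)
  have hc' := congrArg BTree.leaves hc
  rw [BTree.leaves_map, BTree.leaves_map] at hc'
  have : block s q ∈ c.1.leaves.map (block s') := hc' ▸ List.mem_map_of_mem (T.2.2 q)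
  obtain ⟨q', -, h⟩ := List.mem_map.1 this
  exact ⟨q', h⟩

theorem exists_eq_tmul_tprod {ι P : Type*} [AddCommMonoid P] [Module k P] {N : ι → Type*}
    [∀ i, AddCommMonoid (N i)] [∀ i, Module k (N i)] [Finite ι] (c : ∀ i, N i)
    (hc : ∀ i x, ∃ r : k, x = r • c i) (w : P ⊗[k] PiTensorProduct k N) :
    ∃ p : P, w = p ⊗ₜ[k] PiTensorProduct.tprod k c := by
  have := Fintype.ofFinite ι
  have h1 : ∀ y : PiTensorProduct k N, ∃ r : k, y = r • PiTensorProduct.tprod k c := by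
    intro y
    induction y using PiTensorProduct.induction_on with
    | smul_tprod r f =>
      choose a ha using fun i => hc i (f i)
      refine ⟨r * ∏ i, a i, ?_⟩
      rw [funext ha, MultilinearMap.map_smul_univ, smul_smul]
    | add x y hx hy =>
      obtain ⟨a, rfl⟩ := hx
      obtain ⟨b, rfl⟩ := hy
      exact ⟨a + b, by rw [add_smul]⟩
  induction w using TensorProduct.induction_on with
  | zero => exact ⟨0, by simp⟩
  | tmul p y =>
    obtain ⟨r, rfl⟩ := h1 y
    exact ⟨r • p, by rw [TensorProduct.smul_tmul]⟩
  | add x y hx hy =>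
    obtain ⟨a, rfl⟩ := hx
    obtain ⟨b, rfl⟩ := hy
    exact ⟨a + b, by rw [TensorProduct.add_tmul]⟩

-- With a monomial fixed in each block, every element of the summand at s is a Lie element tensored
-- with these monomials. `blockPart s` returns that Lie element and kills the other summands.
open Classical in
theorem xi_zero_injective [Finite A] :
    Function.Injective (xi (comRel k) (lieRel k)
      (0 : F12 k comSign lieSign →ₗ[k] F21 k comSign lieSign) A) := by
  have c : ∀ (s : Setoid A) (q : Quotient s), MTree Unit (Fib (Quotient.mk s) q) := by
    intro s q
    have : Nonempty (Fib (Quotient.mk s) q) := by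
      obtain ⟨a, rfl⟩ := Quotient.exists_rep q
      exact ⟨⟨a, rfl⟩⟩
    exact (MTree.nonempty ()).some
  have hnf : ∀ (s : Setoid A) (w : QuadOp lieSign (lieRel k) (Quotient s) ⊗[k]
      PiTensorProduct k fun q : Quotient s => QuadOp comSign (comRel k) (Fib (Quotient.mk s) q)),
      ∃ x, w = QuadOp.mk lieSign (lieRel k) x ⊗ₜ[k]
        PiTensorProduct.tprod k fun q => QuadOp.mk comSign (comRel k) (FM.mono (c s q)) := by
    intro s w
    obtain ⟨p, rfl⟩ := exists_eq_tmul_tprod _ (fun q => com_eq_smul_mk (c s q)) w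
    obtain ⟨x, rfl⟩ := Submodule.mkQ_surjective _ p
    exact ⟨x, rfl⟩
  set Ξ := xi (comRel k) (lieRel k) (0 : F12 k comSign lieSign →ₗ[k] F21 k comSign lieSign) A
  let tens : ∀ s : Setoid A, FM k Unit (Quotient s) →ₗ[k]
      QuadOp lieSign (lieRel k) (Quotient s) ⊗[k]
        PiTensorProduct k fun q : Quotient s =>
          QuadOp comSign (comRel k) (Fib (Quotient.mk s) q) := fun s =>
    (TensorProduct.mk k _ _).flip
      (PiTensorProduct.tprod k fun q => QuadOp.mk comSign (comRel k) (FM.mono (c s q))) ∘ₗ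
        QuadOp.mk lieSign (lieRel k)
  let lof := DirectSum.lof k (Setoid A) (fun s => QuadOp lieSign (lieRel k) (Quotient s) ⊗[k]
    PiTensorProduct k fun q : Quotient s => QuadOp comSign (comRel k) (Fib (Quotient.mk s) q))
  have hself : ∀ s, blockPart s ∘ₗ Ξ ∘ₗ lof s ∘ₗ tens s = QuadOp.mk lieSign (lieRel k) :=
    fun s => FM.hom_ext fun T =>
      (congrArg _ (xi_lof_mono _ _ _ s T (c s))).trans (blockPart_stack_self s T (c s))
  have hother : ∀ s s', s ≠ s' → blockPart s' ∘ₗ Ξ ∘ₗ lof s ∘ₗ tens s = 0 :=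
    fun s s' h => FM.hom_ext fun T =>
      (congrArg _ (xi_lof_mono _ _ _ s T (c s))).trans (blockPart_stack_of_ne h T (c s))
  -- The matrix of `blockPart` against Ξ is block diagonal.
  have hcomp : ∀ s', blockPart s' ∘ₗ Ξ = (blockPart s' ∘ₗ Ξ ∘ₗ lof s') ∘ₗ
      DirectSum.component k (Setoid A) _ s' := by
    intro s'
    refine DirectSum.linearMap_ext k fun s => LinearMap.ext fun w => ?_
    rcases eq_or_ne s s' with rfl | h
    · simp only [LinearMap.comp_apply, DirectSum.component.lof_self]
      rfl
    · simp only [LinearMap.comp_apply, DirectSum.component.of, h, dif_neg, not_false_iff, map_zero]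
      obtain ⟨x, rfl⟩ := hnf s w
      exact LinearMap.congr_fun (hother s s' h) x
  intro z z' hz
  refine DirectSum.ext_component k fun s => ?_
  obtain ⟨x, hx⟩ := hnf s (DirectSum.component k (Setoid A) _ s z)
  obtain ⟨x', hx'⟩ := hnf s (DirectSum.component k (Setoid A) _ s z')
  have h := LinearMap.congr_fun (hcomp s) z
  have h' := LinearMap.congr_fun (hcomp s) z'
  simp only [LinearMap.comp_apply] at h h'
  rw [hx] at h ⊢
  rw [hx'] at h' ⊢
  rw [← hz] at h'
  have key : QuadOp.mk lieSign (lieRel k) x = QuadOp.mk lieSign (lieRel k) x' :=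
    (LinearMap.congr_fun (hself s) x).symm.trans
      (h.symm.trans (h'.trans (LinearMap.congr_fun (hself s) x')))
  rw [key]

end

section

variable {k : Type u} [Field k] {G A B Y : Type} {M : Type*} [AddCommGroup M] [Module k M]

/-! ### Equivariant maps from `F12` to `F21` -/

section Relations

variable {ε : G → ℤˣ} {R : Set (FM k G (Fin 3))}

/-- An element of the free operad is a relation if it is one in the free algebra on its inputs. -/
theorem mem_relIdeal_of_evalAt_mem {x : FM k G A}
    (hx : FM.evalAt (nodeOp k) (fun a => TM.mono (.leaf a)) x ∈ treeIdeal ε R A) :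
    x ∈ relIdeal ε R A := by
  have h : multilinearPart k G (fun a : A => a) (fun _ _ h => h) ∘ₗ
      FM.evalAt (nodeOp k) (fun a => TM.mono (.leaf a)) = LinearMap.id := FM.hom_ext fun t => by
    rw [LinearMap.comp_apply, FM.evalAt_mono, BTree.eval_nodeOp, BTree.bind_leaf, BTree.map_id,
      multilinearPart_id, LinearMap.id_apply]
  have := multilinearPart_mem (j := fun a : A => a) (fun _ _ h => h) hx
  rw [← LinearMap.comp_apply, h] at this
  exact this

theorem nodeOp_symm (ε : G → ℤˣ) (R : Set (FM k G (Fin 3))) (g : G) (x y : TM k G Y) :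
    nodeOp k g x y - ((ε g : ℤ) : k) • nodeOp k g y x ∈ treeIdeal ε R Y := by
  have := evalAt_mem_treeIdeal (corolla_mem_relIdeal ε R g) ![x, y]
  simpa [BTree.eval] using this

theorem mk_lcomb_swap (g h : G) (σ : Equiv.Perm (Fin 3)) :
    QuadOp.mk ε R (FM.mono (MTree.lcomb g h σ)) =
      ((ε h : ℤ) : k) • QuadOp.mk ε R (FM.mono (MTree.lcomb g h (σ * Equiv.swap 0 1))) := by
  rw [← sub_eq_zero, ← map_smul, ← map_sub, Submodule.mkQ_apply, Submodule.Quotient.mk_eq_zero]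
  refine mem_relIdeal_of_evalAt_mem ?_
  have := nodeOp_mem_left g _ (TM.mono (.leaf (σ 2)))
    (nodeOp_symm ε R h (TM.mono (.leaf (σ 0))) (TM.mono (.leaf (σ 1))))
  have h2 : Equiv.swap (0 : Fin 3) 1 2 = 2 := by decide
  simpa [BTree.eval, h2] using this

theorem mk_rcomb (g h : G) (σ : Equiv.Perm (Fin 3)) :
    QuadOp.mk ε R (FM.mono (MTree.rcomb g h σ)) =
      ((ε g : ℤ) : k) • QuadOp.mk ε R (FM.mono (MTree.lcomb g h (σ * finRotate 3))) := by
  rw [← sub_eq_zero, ← map_smul, ← map_sub, Submodule.mkQ_apply, Submodule.Quotient.mk_eq_zero]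
  refine mem_relIdeal_of_evalAt_mem ?_
  have := nodeOp_symm ε R g (TM.mono (.leaf (σ 0)))
    (TM.mono (.node h (.leaf (σ 1)) (.leaf (σ 2))))
  have h2 : finRotate 3 2 = 0 := rfl
  simpa [BTree.eval, h2] using this

theorem relabel_mk_lcomb (τ : Equiv.Perm (Fin 3)) (g h : G) (σ : Equiv.Perm (Fin 3)) :
    QuadOp.relabel τ (QuadOp.mk ε R (FM.mono (MTree.lcomb g h σ))) =
      QuadOp.mk ε R (FM.mono (MTree.lcomb g h (τ * σ))) :=
  congrArg (QuadOp.mk ε R) (FM.relabel_mono τ (MTree.lcomb g h σ))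

theorem relabel_mk_rcomb (τ : Equiv.Perm (Fin 3)) (g h : G) (σ : Equiv.Perm (Fin 3)) :
    QuadOp.relabel τ (QuadOp.mk ε R (FM.mono (MTree.rcomb g h σ))) =
      QuadOp.mk ε R (FM.mono (MTree.rcomb g h (τ * σ))) :=
  congrArg (QuadOp.mk ε R) (FM.relabel_mono τ (MTree.rcomb g h σ))

end Relations

/-- The element `[x_{σ 0} x_{σ 1}, x_{σ 2}]`. -/
def brMul (k : Type u) [Field k] (σ : Equiv.Perm (Fin 3)) :
    FreeOp k (Sum.elim comSign lieSign) (Fin 3) :=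
  QuadOp.mk _ ∅ (FM.mono (MTree.lcomb (.inr ()) (.inl ()) σ))

/-- The element `x_{σ 0} [x_{σ 1}, x_{σ 2}]`. -/
def mulBr (k : Type u) [Field k] (σ : Equiv.Perm (Fin 3)) :
    FreeOp k (Sum.elim comSign lieSign) (Fin 3) :=
  QuadOp.mk _ ∅ (FM.mono (MTree.rcomb (.inl ()) (.inr ()) σ))

theorem brMul_swap (σ : Equiv.Perm (Fin 3)) : brMul k (σ * Equiv.swap 0 1) = brMul k σ := by
  rw [brMul, brMul, mk_lcomb_swap _ _ σ]
  simp [comSign]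

theorem F21_le :
    F21 k comSign lieSign ≤
      Submodule.span k {brMul k 1, brMul k (finRotate 3), brMul k (finRotate 3 ^ 2)} := by
  have h : ∀ σ, brMul k σ ∈ Submodule.span k
      {brMul k 1, brMul k (finRotate 3), brMul k (finRotate 3 ^ 2)} := by
    intro σ
    -- The three rotations represent the cosets of the subgroup generated by the transposition of
    -- the two factors of the product.
    have h3 : ∀ σ : Equiv.Perm (Fin 3), (σ = 1 ∨ σ = finRotate 3 ∨ σ = finRotate 3 ^ 2) ∨
        (σ * Equiv.swap 0 1 = 1 ∨ σ * Equiv.swap 0 1 = finRotate 3 ∨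
          σ * Equiv.swap 0 1 = finRotate 3 ^ 2) := by decide
    rcases h3 σ with h | h
    · exact Submodule.subset_span (by rcases h with rfl | rfl | rfl <;> simp)
    · refine Submodule.subset_span ?_
      rw [← brMul_swap σ]
      rcases h with h | h | h <;> rw [h]
      · exact Or.inl rfl
      · exact Or.inr (Or.inl rfl)
      · exact Or.inr (Or.inr rfl)
  refine Submodule.span_le.2 ?_
  rintro _ ⟨_, ⟨⟨⟩, rfl⟩, _, ⟨⟨⟩, rfl⟩, σ, rfl | rfl⟩
  · exact h σ
  · rw [mk_rcomb]
    exact Submodule.smul_mem _ _ (h _)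

theorem mulBr_mem (σ : Equiv.Perm (Fin 3)) : mulBr k σ ∈ F12 k comSign lieSign :=
  rcomb_mem_F12 comSign lieSign σ

theorem mulBr_swap (σ : Equiv.Perm (Fin 3)) : mulBr k (σ * Equiv.swap 1 2) = - mulBr k σ := by
  have h : Equiv.swap 1 2 * finRotate 3 = finRotate 3 * Equiv.swap (0 : Fin 3) 1 := by decide
  rw [mulBr, mulBr, mk_rcomb, mk_rcomb, mk_lcomb_swap _ _ (σ * finRotate 3), mul_assoc, mul_assoc, h]
  simp [comSign, lieSign]

/-- Exchanging x₁ and x₂ negates x₀[x₁,x₂], hence its image. On the spanning set of `F21` it fixes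
[x₁x₂,x₀] and exchanges [x₀x₁,x₂] with [x₂x₀,x₁]. -/
theorem exists_eq_smul_of_isEquivariant [CharZero k]
    {D : F12 k comSign lieSign →ₗ[k] F21 k comSign lieSign} (hD : IsEquivariant D) :
    ∃ r : k, (D ⟨mulBr k 1, mulBr_mem 1⟩).1 = r • (brMul k 1 - brMul k (finRotate 3 ^ 2)) := by
  set d := D ⟨mulBr k 1, mulBr_mem 1⟩
  obtain ⟨a, b, c, h⟩ := Submodule.mem_span_triple.1 (F21_le d.2)
  have h1 := hD (Equiv.swap 1 2) ⟨mulBr k 1, mulBr_mem 1⟩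
  have h2 : (⟨QuadOp.relabel (Equiv.swap 1 2) (mulBr k 1), relabel_mem_part3 _ (mulBr_mem 1)⟩ :
      F12 k comSign lieSign) = - ⟨mulBr k 1, mulBr_mem 1⟩ := by
    refine Subtype.ext ?_
    simp only [Submodule.coe_neg]
    rw [← mulBr_swap, mulBr, relabel_mk_rcomb]
    rfl
  rw [h2, map_neg] at h1
  have h3 := congrArg Subtype.val h1
  simp only [Submodule.coe_neg] at h3
  change - d.1 = QuadOp.relabel (Equiv.swap 1 2) d.1 at h3
  have h4 : ∀ σ, QuadOp.relabel (Equiv.swap 1 2) (brMul k σ) = brMul k (Equiv.swap 1 2 * σ) :=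
    fun σ => relabel_mk_lcomb _ _ _ _
  have e1 : Equiv.swap (1 : Fin 3) 2 * 1 = finRotate 3 ^ 2 * Equiv.swap 0 1 := by decide
  have e2 : Equiv.swap (1 : Fin 3) 2 * finRotate 3 = finRotate 3 * Equiv.swap 0 1 := by decide
  have e3 : Equiv.swap (1 : Fin 3) 2 * finRotate 3 ^ 2 = 1 * Equiv.swap 0 1 := by decide
  rw [← h] at h3
  simp only [map_add, map_smul, h4] at h3
  rw [e1, e2, e3] at h3
  simp only [brMul_swap] at h3
  -- Linear independence of the three spanning elements is not available, so a, b, c are not solved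
  -- for. Instead the image d is written as half of d − (−d), with the transposed expansion used for
  -- −d.
  refine ⟨(a - c) / 2, ?_⟩
  rw [← h]
  have h5 : (2 : k) ≠ 0 := two_ne_zero
  have h6 : (2 : k) • (a • brMul k 1 + b • brMul k (finRotate 3) + c • brMul k (finRotate 3 ^ 2)) =
      (2 : k) • (((a - c) / 2) • (brMul k 1 - brMul k (finRotate 3 ^ 2))) := by
    rw [smul_smul, mul_div_cancel₀ _ h5, two_smul]
    nth_rewrite 1 [← neg_neg (a • brMul k 1 + b • brMul k (finRotate 3) +
      c • brMul k (finRotate 3 ^ 2))]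
    rw [h3]
    module
  exact smul_right_injective _ h5 h6

theorem eq_zero_of_isEquivariant {D : F12 k comSign lieSign →ₗ[k] F21 k comSign lieSign}
    (hD : IsEquivariant D) (h : (D ⟨mulBr k 1, mulBr_mem 1⟩).1 = 0) : D = 0 := by
  have hσ : ∀ σ, D ⟨mulBr k σ, mulBr_mem σ⟩ = 0 := by
    intro σ
    have h1 := hD σ ⟨mulBr k 1, mulBr_mem 1⟩
    have h2 : (⟨QuadOp.relabel σ (mulBr k 1), relabel_mem_part3 _ (mulBr_mem 1)⟩ :
        F12 k comSign lieSign) = ⟨mulBr k σ, mulBr_mem σ⟩ :=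
      Subtype.ext ((relabel_mk_rcomb _ _ _ _).trans (by rw [mul_one]; rfl))
    rw [h2] at h1
    rw [h1]
    refine Subtype.ext ?_
    simp [h]
  refine LinearMap.ext fun x => ?_
  obtain ⟨x, hx⟩ := x
  rw [LinearMap.zero_apply]
  induction hx using Submodule.span_induction with
  | zero => exact map_zero D
  | add x y hx hy h1 h2 => exact (map_add D ⟨x, hx⟩ ⟨y, hy⟩).trans (by rw [h1, h2, add_zero])
  | smul c x hx h1 => exact (map_smul D c ⟨x, hx⟩).trans (by rw [h1, smul_zero])
  | mem x hx =>
    obtain ⟨_, ⟨⟨⟩, rfl⟩, _, ⟨⟨⟩, rfl⟩, σ, rfl | rfl⟩ := hx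
    · have h1 : mulBr k (σ * (finRotate 3)⁻¹) =
          QuadOp.mk _ ∅ (FM.mono (MTree.lcomb (.inl ()) (.inr ()) σ)) := by
        rw [mulBr, mk_rcomb]
        simp [comSign]
      simpa only [h1] using hσ (σ * (finRotate 3)⁻¹)
    · exact hσ σ

/-! ### The obstruction in arity four -/

section Obstruction

variable {D : F12 k comSign lieSign →ₗ[k] F21 k comSign lieSign} {r : k}

/-- The relations of the free algebra over the combined operad. -/
abbrev combIdeal (D : F12 k comSign lieSign →ₗ[k] F21 k comSign lieSign) (Y : Type) :
    Submodule k (TM k (Unit ⊕ Unit) Y) :=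
  treeIdeal (Sum.elim comSign lieSign) (combinedRel (comRel k) (lieRel k) D) Y

theorem combIdeal_mul_br
    (hr : (D ⟨mulBr k 1, mulBr_mem 1⟩).1 = r • (brMul k 1 - brMul k (finRotate 3 ^ 2)))
    (x y z : TM k (Unit ⊕ Unit) Y) :
    nodeOp k (.inl ()) x (nodeOp k (.inr ()) y z) -
      r • (nodeOp k (.inr ()) (nodeOp k (.inl ()) x y) z -
        nodeOp k (.inr ()) (nodeOp k (.inl ()) z x) y) ∈ combIdeal D Y := by
  have h : FM.mono (MTree.rcomb (.inl ()) (.inr ()) 1) -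
      r • (FM.mono (MTree.lcomb (.inr ()) (.inl ()) 1) -
        FM.mono (MTree.lcomb (.inr ()) (.inl ()) (finRotate 3 ^ 2))) ∈
      combinedRel (comRel k) (lieRel k) D := by
    refine Or.inr ⟨⟨mulBr k 1, mulBr_mem 1⟩, ?_⟩
    rw [hr, map_sub, map_smul, map_sub]
    rfl
  have := evalAt_mem_treeIdeal (mem_relIdeal_of_mem (ε := Sum.elim comSign lieSign) h) ![x, y, z]
  have e0 : (finRotate 3 ^ 2) 0 = 2 := by decide
  have e1 : (finRotate 3 ^ 2) 1 = 0 := by decide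
  have e2 : (finRotate 3 ^ 2) 2 = 1 := by decide
  simpa [BTree.eval, e0, e1, e2] using this

theorem combIdeal_assoc (D : F12 k comSign lieSign →ₗ[k] F21 k comSign lieSign)
    (x y z : TM k (Unit ⊕ Unit) Y) :
    nodeOp k (.inl ()) (nodeOp k (.inl ()) x y) z - nodeOp k (.inl ()) x (nodeOp k (.inl ()) y z) ∈
      combIdeal D Y := by
  have := evalAt_mem_treeIdeal (mem_relIdeal_of_mem (ε := Sum.elim comSign lieSign)
    (mapGen_inl_mem (comRel k) (lieRel k) D _ rfl)) ![x, y, z]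
  simpa [FM.mapGen_mono, BTree.eval, BTree.mapGen] using this

/-- The two ways of computing `x y [z, w]`. -/
theorem combIdeal_four
    (hr : (D ⟨mulBr k 1, mulBr_mem 1⟩).1 = r • (brMul k 1 - brMul k (finRotate 3 ^ 2)))
    (x y z w : TM k (Unit ⊕ Unit) Y) :
    let mul := nodeOp k (G := Unit ⊕ Unit) (Y := Y) (.inl ())
    let br := nodeOp k (G := Unit ⊕ Unit) (Y := Y) (.inr ())
    r • br (mul (mul x y) z) w - r • br (mul w (mul x y)) z - r ^ 2 • br (mul x (mul y z)) w +
      r ^ 2 • br (mul w x) (mul y z) + r ^ 2 • br (mul x (mul w y)) z -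
      r ^ 2 • br (mul z x) (mul w y) ∈ combIdeal D Y := by
  intro mul br
  have h1 := combIdeal_mul_br hr (mul x y) z w
  have h2 := combIdeal_assoc D x y (br z w)
  have h3 := nodeOp_mem_right (.inl ()) x _ (combIdeal_mul_br hr y z w)
  have h4 := combIdeal_mul_br hr x (mul y z) w
  have h5 := combIdeal_mul_br hr x (mul w y) z
  simp only [map_sub, map_smul] at h3
  change mul (mul x y) (br z w) - r • (br (mul (mul x y) z) w - br (mul w (mul x y)) z) ∈ _ at h1
  change mul (mul x y) (br z w) - mul x (mul y (br z w)) ∈ _ at h2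
  change mul x (mul y (br z w)) - r • (mul x (br (mul y z) w) - mul x (br (mul w y) z)) ∈ _ at h3
  change mul x (br (mul y z) w) - r • (br (mul x (mul y z)) w - br (mul w x) (mul y z)) ∈ _ at h4
  change mul x (br (mul w y) z) - r • (br (mul x (mul w y)) z - br (mul z x) (mul w y)) ∈ _ at h5
  -- In this combination all products having a bracket as a factor cancel, leaving only brackets of
  -- products.
  have := add_mem (sub_mem h2 h1) (add_mem h3 (Submodule.smul_mem _ r (sub_mem h4 h5)))
  convert this using 1
  module

/-- Allows the factors of a composite to be given as trees with labels in A; for concrete trees the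
hypotheses are decidable. -/
theorem exists_fib_trees (f : A → B) (u : B → BTree G A) (hnd : ∀ b, (u b).leaves.Nodup)
    (hu : ∀ a b, a ∈ (u b).leaves ↔ f a = b) :
    ∃ w : ∀ b, MTree G (Fib f b), ∀ b, (w b).1.map Subtype.val = u b := by
  have h : ∀ b, ∃ w : BTree G (Fib f b), w.map Subtype.val = u b := fun b =>
    BTree.exists_map_eq _ _ fun a ha => ⟨⟨a, (hu a b).1 ha⟩, rfl⟩
  choose w hw using h
  have hl : ∀ b, (w b).leaves.map Subtype.val = (u b).leaves := fun b => by
    rw [← BTree.leaves_map, hw]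
  refine ⟨fun b => ⟨w b, ?_, fun a => ?_⟩, hw⟩
  · have := hnd b
    rw [← hl] at this
    exact this.of_map
  · have := (hu a.1 b).2 a.2
    rw [← hl] at this
    obtain ⟨a', ha', h⟩ := List.mem_map.1 this
    rwa [← Subtype.ext h]

/-- The product `k × k → k × k` of the two-dimensional nonabelian Lie algebra. -/
def affineBracket (k : Type u) [Field k] : k × k →ₗ[k] k × k →ₗ[k] k × k :=
  LinearMap.mk₂ k (fun x y => (0, x.1 * y.2 - x.2 * y.1))
    (fun x y z => by ext <;> simp; ring) (fun c x y => by ext <;> simp; ring)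
    (fun x y z => by ext <;> simp; ring) (fun c x y => by ext <;> simp; ring)

theorem affineBracket_apply (x y : k × k) :
    affineBracket k x y = (0, x.1 * y.2 - x.2 * y.1) := rfl

theorem lie_relIdeal_le : relIdeal lieSign (lieRel k) A ≤
    FM.evalIdeal (fun _ => affineBracket k) ⊥ A := by
  refine FM.relIdeal_le_evalIdeal _ (fun g x y hx => by simp [(Submodule.mem_bot k).1 hx])
    (fun g x y hy => by simp [(Submodule.mem_bot k).1 hy]) (fun g x y => ?_) ?_
  · rw [Submodule.mem_bot]
    ext <;> simp [lieSign, affineBracket_apply]; ring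
  · rintro _ rfl v
    rw [Submodule.mem_bot]
    have e0 : (finRotate 3 ^ 2) 0 = 2 := by decide
    have e1 : (finRotate 3 ^ 2) 1 = 0 := by decide
    have e2 : (finRotate 3 ^ 2) 2 = 1 := by decide
    have e3 : finRotate 3 2 = 0 := by decide
    ext <;> simp [BTree.eval, affineBracket_apply, e0, e1, e2, e3]; ring

theorem com_relIdeal_le : relIdeal comSign (comRel k) A ≤
    FM.evalIdeal (fun _ => LinearMap.mul k k) ⊥ A := by
  refine FM.relIdeal_le_evalIdeal _ (fun g x y hx => by simp [(Submodule.mem_bot k).1 hx])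
    (fun g x y hy => by simp [(Submodule.mem_bot k).1 hy]) (fun g x y => ?_) ?_
  · simp [comSign, mul_comm x y]
  · rintro _ rfl v
    simp [BTree.eval, mul_assoc]

/-- Evaluation of a presented operad in one of its algebras. -/
def QuadOp.evalAt {ε : G → ℤˣ} {R : Set (FM k G (Fin 3))} (ops : G → M →ₗ[k] M →ₗ[k] M)
    (h : relIdeal ε R A ≤ FM.evalIdeal ops ⊥ A) (v : A → M) : QuadOp ε R A →ₗ[k] M :=
  Submodule.liftQ _ (FM.evalAt ops v) fun _ hx =>
    (Submodule.mem_bot k).1 ((FM.mem_evalIdeal _).1 (h hx) v)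

theorem QuadOp.evalAt_mk_mono {ε : G → ℤˣ} {R : Set (FM k G (Fin 3))}
    (ops : G → M →ₗ[k] M →ₗ[k] M) (h : relIdeal ε R A ≤ FM.evalIdeal ops ⊥ A) (v : A → M)
    (t : MTree G A) : QuadOp.evalAt ops h v (QuadOp.mk ε R (FM.mono t)) = t.1.eval ops v :=
  (Submodule.liftQ_apply _ _ _).trans (FM.evalAt_mono ops t v)

theorem tmul_tprod_ne_zero {ι P : Type*} [AddCommMonoid P] [Module k P] {N : ι → Type*}
    [∀ i, AddCommMonoid (N i)] [∀ i, Module k (N i)] [Finite ι] (φ : P →ₗ[k] k)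
    (ψ : ∀ i, N i →ₗ[k] k) (p : P) (y : ∀ i, N i) (hp : φ p ≠ 0) (hy : ∀ i, ψ i (y i) ≠ 0) :
    p ⊗ₜ[k] PiTensorProduct.tprod k y ≠ 0 := by
  have := Fintype.ofFinite ι
  intro h
  have := congrArg (LinearMap.mul' k k ∘ₗ TensorProduct.map φ
    (PiTensorProduct.lift ((MultilinearMap.mkPiAlgebra k ι k).compLinearMap ψ))) h
  simp [hp, Finset.prod_eq_zero_iff, hy] at this

/-- Nonvanishing is detected by evaluating each factor in an algebra: the bracket in the nonabelian
two-dimensional Lie algebra, where [(1,0),(0,1)] = (0,1), and the products in k with all inputs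
equal to 1. -/
theorem stackTensor_corolla_ne_zero (f : A → Fin 2) (hf : Function.Surjective f)
    (w : ∀ b, MTree Unit (Fib f b)) :
    stackTensor (ε₁ := comSign) (ε₂ := lieSign) (comRel k) (lieRel k) f hf (MTree.corolla () 1) w ≠
      0 := by
  have := Finite.of_equiv _ (Setoid.quotientKerEquivOfSurjective f hf).symm
  refine tmul_tprod_ne_zero
    (LinearMap.snd k k k ∘ₗ QuadOp.evalAt (fun _ => affineBracket k) lie_relIdeal_le
      fun q => if Setoid.quotientKerEquivOfSurjective f hf q = 0 then (1, 0) else (0, 1))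
    (fun q => QuadOp.evalAt (fun _ => LinearMap.mul k k) com_relIdeal_le fun _ => 1) _ _ ?_
    fun q => ?_
  · rw [LinearMap.comp_apply, QuadOp.evalAt_mk_mono]
    simp [BTree.map, BTree.eval, affineBracket_apply]
  · rw [QuadOp.evalAt_mk_mono]
    have : ∀ {C : Type} (t : BTree Unit C),
        t.eval (fun _ => LinearMap.mul k k) (fun _ => 1) = 1 := by
      intro C t
      induction t with
      | leaf a => rfl
      | node g l r hl hr => simp [BTree.eval, hl, hr]
    rw [this]
    exact one_ne_zero

theorem evalAt_stack_corolla (f : A → Fin 2) (u : Fin 2 → BTree Unit A)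
    (w : ∀ b, MTree Unit (Fib f b)) (hw : ∀ b, (w b).1.map Subtype.val = u b) :
    FM.evalAt (nodeOp k) (fun a => TM.mono (.leaf a))
        (FM.mono (stack f (MTree.corolla () 1) w)) =
      nodeOp k (.inr ()) ((u 0).eval (fun _ => nodeOp k (.inl ())) fun a => TM.mono (.leaf a))
        ((u 1).eval (fun _ => nodeOp k (.inl ())) fun a => TM.mono (.leaf a)) := by
  rw [FM.evalAt_mono, stack, MTree.comp_val, BTree.eval_bind, MTree.mapGen_val, BTree.eval_mapGen]
  simp only [BTree.eval_map, MTree.mapGen_val, BTree.eval_mapGen, ← hw]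
  rfl

theorem eq_zero_of_xi_injective
    (hr : (D ⟨mulBr k 1, mulBr_mem 1⟩).1 = r • (brMul k 1 - brMul k (finRotate 3 ^ 2)))
    (hinj : Function.Injective (xi (comRel k) (lieRel k) D (Fin 4))) : r = 0 := by
  classical
  -- The labels 0, 1, 2, 3 stand for x, y, z, w, and the six composites are the terms of
  -- `combIdeal_four` in order. The vectors send a label to the side of the bracket on which it
  -- occurs.
  let x : Fin 4 → BTree Unit (Fin 4) := fun i => .leaf i
  let mul : BTree Unit (Fin 4) → BTree Unit (Fin 4) → BTree Unit (Fin 4) := .node ()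
  obtain ⟨w₁, h₁⟩ := exists_fib_trees ![0, 0, 0, 1] ![mul (mul (x 0) (x 1)) (x 2), x 3]
    (by decide) (by decide)
  obtain ⟨w₂, h₂⟩ := exists_fib_trees ![0, 0, 1, 0] ![mul (x 3) (mul (x 0) (x 1)), x 2]
    (by decide) (by decide)
  obtain ⟨w₃, h₃⟩ := exists_fib_trees ![0, 0, 0, 1] ![mul (x 0) (mul (x 1) (x 2)), x 3]
    (by decide) (by decide)
  obtain ⟨w₄, h₄⟩ := exists_fib_trees ![0, 1, 1, 0] ![mul (x 3) (x 0), mul (x 1) (x 2)]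
    (by decide) (by decide)
  obtain ⟨w₅, h₅⟩ := exists_fib_trees ![0, 0, 1, 0] ![mul (x 0) (mul (x 3) (x 1)), x 2]
    (by decide) (by decide)
  obtain ⟨w₆, h₆⟩ := exists_fib_trees ![0, 1, 0, 1] ![mul (x 2) (x 0), mul (x 3) (x 1)]
    (by decide) (by decide)
  have hrel := combIdeal_four hr (TM.mono (.leaf (0 : Fin 4))) (TM.mono (.leaf 1))
    (TM.mono (.leaf 2)) (TM.mono (.leaf 3))
  have hX : r • FM.mono (stack _ (MTree.corolla () 1) w₁) -
      r • FM.mono (stack _ (MTree.corolla () 1) w₂) -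
      r ^ 2 • FM.mono (stack _ (MTree.corolla () 1) w₃) +
      r ^ 2 • FM.mono (stack _ (MTree.corolla () 1) w₄) +
      r ^ 2 • FM.mono (stack _ (MTree.corolla () 1) w₅) -
      r ^ 2 • FM.mono (stack _ (MTree.corolla () 1) w₆) ∈
        relIdeal (Sum.elim comSign lieSign) (combinedRel (comRel k) (lieRel k) D) (Fin 4) := by
    refine mem_relIdeal_of_evalAt_mem ?_
    simp only [map_add, map_sub, map_smul, evalAt_stack_corolla _ _ _ h₁,
      evalAt_stack_corolla _ _ _ h₂, evalAt_stack_corolla _ _ _ h₃, evalAt_stack_corolla _ _ _ h₄,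
      evalAt_stack_corolla _ _ _ h₅, evalAt_stack_corolla _ _ _ h₆]
    exact hrel
  have s₁ : Function.Surjective (![0, 0, 0, 1] : Fin 4 → Fin 2) := by decide
  have s₂ : Function.Surjective (![0, 0, 1, 0] : Fin 4 → Fin 2) := by decide
  have s₄ : Function.Surjective (![0, 1, 1, 0] : Fin 4 → Fin 2) := by decide
  have s₆ : Function.Surjective (![0, 1, 0, 1] : Fin 4 → Fin 2) := by decide
  -- Only the last term has the partition {0,2},{1,3}: four of the others have a singleton block,
  -- and the remaining one has {0,3},{1,2}.
  have n₁ : Setoid.ker (![0, 0, 0, 1] : Fin 4 → Fin 2) ≠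
      Setoid.ker (![0, 1, 0, 1] : Fin 4 → Fin 2) := fun h =>
    absurd (Setoid.ker_def.1 ((Setoid.ext_iff.1 h 0 1).1 rfl)) (by decide)
  have n₂ : Setoid.ker (![0, 0, 1, 0] : Fin 4 → Fin 2) ≠
      Setoid.ker (![0, 1, 0, 1] : Fin 4 → Fin 2) := fun h =>
    absurd (Setoid.ker_def.1 ((Setoid.ext_iff.1 h 0 1).1 rfl)) (by decide)
  have n₄ : Setoid.ker (![0, 1, 1, 0] : Fin 4 → Fin 2) ≠
      Setoid.ker (![0, 1, 0, 1] : Fin 4 → Fin 2) := fun h =>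
    absurd (Setoid.ker_def.1 ((Setoid.ext_iff.1 h 0 3).1 rfl)) (by decide)
  rw [← Submodule.Quotient.mk_eq_zero, ← Submodule.mkQ_apply] at hX
  simp only [map_add, map_sub, map_smul] at hX
  let lof := DirectSum.lof k (Setoid (Fin 4)) fun s =>
    QuadOp lieSign (lieRel k) (Quotient s) ⊗[k]
      PiTensorProduct k fun q : Quotient s => QuadOp comSign (comRel k) (Fib (Quotient.mk s) q)
  let tens := fun (f : Fin 4 → Fin 2) (hf : Function.Surjective f)
    (w : ∀ b, MTree Unit (Fib f b)) => lof _
      (stackTensor (ε₁ := comSign) (ε₂ := lieSign) (comRel k) (lieRel k) f hf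
        (MTree.corolla () 1) w)
  have hxi : ∀ f hf w, xi (comRel k) (lieRel k) D (Fin 4) (tens f hf w) =
      QuadOp.mk _ _ (FM.mono (stack f (MTree.corolla () 1) w)) := fun f hf w => by
    convert xi_stackTensor (comRel k) (lieRel k) D f hf (MTree.corolla () 1) w
  have hZ : xi (comRel k) (lieRel k) D (Fin 4)
      (r • tens _ s₁ w₁ + r ^ 2 • tens _ s₄ w₄ + r ^ 2 • tens _ s₂ w₅) =
      xi (comRel k) (lieRel k) D (Fin 4)
        (r • tens _ s₂ w₂ + r ^ 2 • tens _ s₁ w₃ + r ^ 2 • tens _ s₆ w₆) := by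
    simp only [map_add, map_smul, hxi]
    rw [← sub_eq_zero, ← hX]
    abel
  have hother : ∀ f hf w, Setoid.ker f ≠ Setoid.ker (![0, 1, 0, 1] : Fin 4 → Fin 2) →
      DirectSum.component k (Setoid (Fin 4)) _ (Setoid.ker (![0, 1, 0, 1] : Fin 4 → Fin 2))
        (tens f hf w) = 0 := fun f hf w h =>
    (DirectSum.component.of ..).trans (dif_neg h)
  -- Injectivity lifts the relation to the direct sum; its component at {0,2},{1,3} reads 0 = r²
  -- times the tensor of [zx,wy].
  have h := congrArg (DirectSum.component k (Setoid (Fin 4)) _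
    (Setoid.ker (![0, 1, 0, 1] : Fin 4 → Fin 2))) (hinj hZ)
  simp only [map_add, map_smul, hother _ s₁ _ n₁, hother _ s₂ _ n₂, hother _ s₄ _ n₄,
    tens, lof, DirectSum.component.lof_self, smul_zero, zero_add] at h
  by_contra h0
  have h2 := congrArg (fun y => (r ^ 2)⁻¹ • y) h
  simp only [smul_zero, inv_smul_smul₀ (pow_ne_zero 2 h0)] at h2
  exact stackTensor_corolla_ne_zero _ s₆ w₆ h2.symm

end Obstruction

/-! ### Conclusion -/

theorem isEquivariant_zero : IsEquivariant (0 : F12 k comSign lieSign →ₗ[k] F21 k comSign lieSign) :=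
  fun σ x => Subtype.ext (by simp)

end

end OperadDL

end

theorem mainTheorem7 {k : Type*} [Field k] [CharZero k]
    (D : OperadDL.F12 k OperadDL.comSign OperadDL.lieSign →ₗ[k]
      OperadDL.F21 k OperadDL.comSign OperadDL.lieSign) :
    OperadDL.IsDistributiveLaw (OperadDL.comRel k) (OperadDL.lieRel k) D ↔ D = 0 := by
  constructor
  · rintro ⟨hD, hbij⟩
    obtain ⟨r, hr⟩ := OperadDL.exists_eq_smul_of_isEquivariant hD
    have h0 := OperadDL.eq_zero_of_xi_injective hr (hbij 4 (by norm_num)).1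
    exact OperadDL.eq_zero_of_isEquivariant hD (by rw [hr, h0, zero_smul])
  · rintro rfl
    exact ⟨OperadDL.isEquivariant_zero, fun n _ =>
      ⟨OperadDL.xi_zero_injective, OperadDL.xi_zero_surjective _ _ _ _⟩⟩
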